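/- Let $0<d_2<d_1<1$ and put $z_1=d_1$, $z_2=d_2$, $z_3=1-d_2$, $z_4=1+d_1$. Define $$a_1(t)=\frac{z_2z_4+z_3t}{z_1-t},\qquad a_2(t)=\frac{z_1z_4-z_3t}{z_2+t},\qquad a_3(t)=t,\qquad \psi(t)=\frac{a_3(t)}{a_1(t)^2a_2(t)},$$ $$cf(t,s)=\frac{t-s}{ts\,z_3+z_1z_2z_4},\qquad J_1=\left(\frac{z_1z_4}{z_3},\infty\right),\qquad J_2=(0,z_1).$$ Consider the discrete equation, for $f=(f^m_n)_{m,n\in\mathbb Z}$, $$(1+d_1)f^{m-1}_{n}f^{m+1}_{n+1}=d_1f^{m+1}_{n}f^{m-1}_{n+1}+d_2f^m_{n-1}f^m_{n+2}+(1-d_2)f^m_nf^m_{n+1}\qquad(m,n\in\mathbb Z).\tag{$*$}$$ (1) Let $N\ge 0$ and let $c_i,t_i,s_i$ $(1\le i\le N)$ be real numbers such that, for each $i$, $t_i$ and $s_i$ lie in the same interval, $J_1$ or $J_2$ (which one may depend on $i$), and satisfy the dispersion relation $\psi(t_i)=\psi(s_i)$; suppose also that $t_i\ne s_j$ whenever $i\neq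 j$, so that the quantities $b_{ij}$ below are defined. Then $$f^m_n=\sum_{I\subseteq\{1,\dots,N\}}\ \prod_{i\in I}c_i\frac{\phi(t_i)}{\phi(s_i)}\prod_{i,j\in I,\ i<j}b_{ij},\qquad \phi(t)=\left(\frac{a_3(t)}{a_1(t)}\right)^m a_1(t)^n,\qquad b_{ij}=\frac{cf(t_i,t_j)\,cf(s_i,s_j)}{cf(s_i,t_j)\,cf(t_i,s_j)},$$ satisfies $(*)$. If moreover $c_i>0$ for all $i$, then $f^m_n>0$ for all $m,n\in\mathbb Z$. (2) Each of the intervals $J=J_1$ and $J=J_2$ contains exactly one critical point of $\psi$ (a zero of $\psi'$), and for every $t\in J$ other than this critical point there is a unique $s\in J$ with $s\ne t$ and $\psi(s)=\psi(t)$. (3) For $d_2=0$ (and the same $d_1$), equation $(*)$ is the bilinear discrete KdV equation $(1+d_1)f^{m-1}_{n}f^{m+1}_{n+1}=d_1f^{m+1}_{n}f^{m-1}_{n+1}+f^m_nf^m_{n+1}$. -/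

import Mathlib

namespace DMix

noncomputable section

/-- The coefficients, normalised by two parameters, with `z₁ + z₂ + z₃ - z₄ = 0`. -/
def z₁ (d₁ _d₂ : ℝ) : ℝ := d₁
def z₂ (_d₁ d₂ : ℝ) : ℝ := d₂
def z₃ (_d₁ d₂ : ℝ) : ℝ := 1 - d₂
def z₄ (d₁ _d₂ : ℝ) : ℝ := 1 + d₁

def a₁ (d₁ d₂ t : ℝ) : ℝ := (z₂ d₁ d₂ * z₄ d₁ d₂ + z₃ d₁ d₂ * t) / (z₁ d₁ d₂ - t)
def a₂ (d₁ d₂ t : ℝ) : ℝ := (z₁ d₁ d₂ * z₄ d₁ d₂ - z₃ d₁ d₂ * t) / (z₂ d₁ d₂ + t)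
def a₃ (_d₁ _d₂ t : ℝ) : ℝ := t

def cf (d₁ d₂ t s : ℝ) : ℝ :=
  (t - s) / (t * s * z₃ d₁ d₂ + z₁ d₁ d₂ * z₂ d₁ d₂ * z₄ d₁ d₂)

/-- The coupling factor of the solitons with parameters `(t, s)` and `(t', s')`. -/
def b (d₁ d₂ t s t' s' : ℝ) : ℝ :=
  (cf d₁ d₂ t t' * cf d₁ d₂ s s') / (cf d₁ d₂ s t' * cf d₁ d₂ t s')

def φ (d₁ d₂ : ℝ) (m n : ℤ) (t : ℝ) : ℝ :=
  (a₃ d₁ d₂ t / a₁ d₁ d₂ t) ^ m * a₁ d₁ d₂ t ^ n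

/-- The dispersion function: the dispersion relation is `ψ t = ψ s`. -/
def ψ (d₁ d₂ t : ℝ) : ℝ := a₃ d₁ d₂ t / (a₁ d₁ d₂ t ^ 2 * a₂ d₁ d₂ t)

def J₁ (d₁ d₂ : ℝ) : Set ℝ := Set.Ioi (z₁ d₁ d₂ * z₄ d₁ d₂ / z₃ d₁ d₂)
def J₂ (d₁ d₂ : ℝ) : Set ℝ := Set.Ioo 0 (z₁ d₁ d₂)

/-- The `N`-soliton function `f^m_n`, a sum over all subsets `I` of the `N` indices. -/
def soliton (d₁ d₂ : ℝ) {N : ℕ} (c t s : Fin N → ℝ) (m n : ℤ) : ℝ :=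
  ∑ I : Finset (Fin N),
    (∏ i ∈ I, c i * (φ d₁ d₂ m n (t i) / φ d₁ d₂ m n (s i))) *
      ∏ i ∈ I, ∏ j ∈ I with i < j, b d₁ d₂ (t i) (s i) (t j) (s j)

/-- `f` (first argument `m`, second argument `n`) solves the discrete bilinear equation. -/
def IsSolution (d₁ d₂ : ℝ) (f : ℤ → ℤ → ℝ) : Prop :=
  ∀ m n : ℤ, (1 + d₁) * (f (m - 1) n * f (m + 1) (n + 1)) =
    d₁ * (f (m + 1) n * f (m - 1) (n + 1)) + d₂ * (f m (n - 1) * f m (n + 2)) +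
      (1 - d₂) * (f m n * f m (n + 1))

/-- `f` solves the discrete KdV equation in bilinear form. -/
def IsDiscreteKdVSolution (d₁ : ℝ) (f : ℤ → ℤ → ℝ) : Prop :=
  ∀ m n : ℤ, (1 + d₁) * (f (m - 1) n * f (m + 1) (n + 1)) =
    d₁ * (f (m + 1) n * f (m - 1) (n + 1)) + f m n * f m (n + 1)

end

end DMix

/-!
Each soliton factor `cf(x, t) / cf(x, s)` evaluated at the zero of `aₖ` is `aₖ(t) / aₖ(s)`, so that
`(*)` is a Miwa-type equation: its nodes are the three zeros of the `aₖ`, and the dispersion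
relation says that multiplying by `aₖ(t) / aₖ(s)` is a shift of the lattice. For two sets `I`, `I'`
of solitons, the quotient of their joint effects satisfies a partial fraction identity; its residues
at the nodes are the coefficients of `(*)`, and its residues at a soliton parameter cancel against
those of the pair in which that soliton has moved from `I` to `I'`. The poles have to be simple for
this, and coinciding parameters are reached as a limit.

The logarithmic derivative of `ψ`, multiplied by `(t - p) * (t - z₁)` where `p` is the zero of `a₁`,
is `t` plus a constant plus simple fractions with negative residues, hence strictly increasing on
each interval. So `ψ` is unimodal there, level sets are pairs, and two pairs of one interval are
nested, which makes the couplings nonnegative.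
-/

namespace DMix

section

open Finset Polynomial Filter Topology
open scoped symmDiff

section PairFactor

variable {F : Type*} [Field F]

/-- The pair factor `(x - y) / (x * y + κ)`. For `κ = z₁ z₂ z₄ / z₃` it is `cf` times the
constant `z₃`. -/
def pairFactor (κ x y : F) : F := (x - y) / (x * y + κ)

variable {κ : F}

theorem neg_pairFactor (κ x y : F) : -pairFactor κ x y = pairFactor κ y x := by
  rw [pairFactor, pairFactor, ← neg_div, neg_sub, mul_comm]

theorem pairFactor_ne_zero {x y : F} (hxy : x ≠ y) (h : x * y + κ ≠ 0) : pairFactor κ x y ≠ 0 :=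
  div_ne_zero (sub_ne_zero.2 hxy) h

theorem inv_pairFactor_reflect_right {x y : F} (hy : y ≠ 0) :
    (pairFactor κ x (-κ / y))⁻¹ = -κ * pairFactor κ x y := by
  have hnum : x * (-κ / y) + κ = -κ * (x - y) / y := by field_simp; ring
  have hden : x - -κ / y = (x * y + κ) / y := by field_simp; ring
  rw [pairFactor, pairFactor, hnum, hden, inv_div, div_div_div_cancel_right₀ hy, mul_div_assoc]

theorem inv_pairFactor_reflect_left {x y : F} (hx : x ≠ 0) :
    (pairFactor κ (-κ / x) y)⁻¹ = -κ * pairFactor κ x y := by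
  rw [← neg_pairFactor, inv_neg, inv_pairFactor_reflect_right hx, ← neg_pairFactor κ x]
  ring

theorem pairFactor_reflect (hκ : κ ≠ 0) {x y : F} (hx : x ≠ 0) (hy : y ≠ 0) :
    pairFactor κ (-κ / x) (-κ / y) = pairFactor κ x y := by
  rw [← inv_inv (pairFactor κ (-κ / x) _), inv_pairFactor_reflect_right hy, mul_inv,
    inv_pairFactor_reflect_left hx, inv_mul_cancel_left₀ (neg_ne_zero.2 hκ)]

end PairFactor

section PartialFractions

variable {F : Type*} [Field F]

/-- Modulo `X ^ 2 + κ` the factor `y * X + κ` is `-X * (X - y)`. -/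
theorem X_sq_add_C_dvd_prod {α : Type*} (κ : F) (s : Finset α) (y : α → F) {m : ℕ}
    (hs : #s = 2 * m + 1) :
    (X ^ 2 + C κ : F[X]) ∣
      ∏ l ∈ s, (C (y l) * X + C κ) + C ((-κ) ^ m) * (X * ∏ l ∈ s, (X - C (y l))) := by
  rw [← AdjoinRoot.mk_eq_zero]
  set f := AdjoinRoot.mk (X ^ 2 + C κ : F[X])
  have hf : f X ^ 2 = -f (C κ) := by
    rw [← map_pow, eq_neg_iff_add_eq_zero, ← map_add, AdjoinRoot.mk_self]
  have hfac : ∀ l, f (C (y l) * X + C κ) = -f X * f (X - C (y l)) := fun l => by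
    simp only [map_add, map_mul, map_sub]
    linear_combination hf
  simp only [map_add, map_prod, hfac, prod_mul_distrib, prod_const, hs, map_mul, map_pow, map_neg]
  have hpow : (-f X) ^ (2 * m + 1) = (-f (C κ)) ^ m * -f X := by
    rw [pow_succ (-f X), pow_mul, neg_sq, hf]
  rw [hpow]
  ring

theorem exists_eval_mul_eq_prod {α : Type*} (κ : F) {s : Finset α} (y : α → F) {m : ℕ}
    (hs : #s = 2 * m + 1) :
    ∃ Q : F[X], Q.natDegree ≤ 2 * m ∧ Q.coeff (2 * m) = (-κ) ^ m ∧
      ∀ j ∈ s, (y j * y j + κ) * Q.eval (y j) = ∏ l ∈ s, (y j * y l + κ) := by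
  obtain ⟨Q, hQ⟩ := X_sq_add_C_dvd_prod κ s y hs
  set P : F[X] := ∏ l ∈ s, (C (y l) * X + C κ)
  set M : F[X] := X * ∏ l ∈ s, (X - C (y l))
  have hmonic : (X ^ 2 + C κ : F[X]).Monic := monic_X_pow_add_C κ two_ne_zero
  have hP : P.natDegree ≤ 2 * m + 1 := by
    refine (natDegree_prod_le _ _).trans ((sum_le_card_nsmul _ _ 1 fun l _ => ?_).trans ?_)
    · exact natDegree_linear_le
    · rw [hs, smul_eq_mul, mul_one]
  have hM : M.Monic := monic_X.mul (monic_prod_X_sub_C y s)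
  have hMdeg : M.natDegree = 2 + 2 * m := by
    rw [natDegree_X_mul (monic_prod_X_sub_C y s).ne_zero, natDegree_finsetProd_X_sub_C_eq_card, hs]
    ring
  have hQdeg : Q.natDegree ≤ 2 * m := by
    rcases eq_or_ne Q 0 with rfl | hQ0
    · simp only [natDegree_zero, zero_le]
    have hdeg := congrArg natDegree hQ
    rw [hmonic.natDegree_mul' hQ0, natDegree_X_pow_add_C] at hdeg
    have : (P + C ((-κ) ^ m) * M).natDegree ≤ 2 + 2 * m :=
      natDegree_add_le_of_degree_le (hP.trans (by lia)) ((natDegree_C_mul_le _ _).trans hMdeg.le)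
    lia
  refine ⟨Q, hQdeg, ?_, fun j hj => ?_⟩
  · have hcoeff := congrArg (coeff · (2 + 2 * m)) hQ
    simp only [coeff_add, coeff_C_mul] at hcoeff
    rw [coeff_mul_add_eq_of_natDegree_le natDegree_X_pow_add_C.le hQdeg,
      coeff_eq_zero_of_natDegree_lt (hP.trans_lt (by lia)), ← hMdeg, hM.coeff_natDegree,
      zero_add, mul_one, coeff_add, coeff_X_pow_self, coeff_C_succ, add_zero, one_mul] at hcoeff
    exact hcoeff.symm
  · have heval := congrArg (eval (y j)) hQ
    simp only [P, M, eval_add, eval_mul, eval_prod, eval_sub, eval_pow, eval_X, eval_C] at heval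
    rw [prod_eq_zero (f := fun l => y j - y l) hj (sub_self _), mul_zero, mul_zero, add_zero, sq]
      at heval
    exact heval.symm.trans (prod_congr rfl fun l _ => by rw [mul_comm])

theorem sum_prod_inv_pairFactor {α : Type*} [DecidableEq α] {κ : F} {s : Finset α} {y : α → F}
    (hy : Set.InjOn y s) (hκ : ∀ j ∈ s, y j * y j + κ ≠ 0) {m : ℕ} (hs : #s = 2 * m + 1) :
    ∑ j ∈ s, ∏ l ∈ s.erase j, (pairFactor κ (y j) (y l))⁻¹ = (-κ) ^ m := by
  obtain ⟨Q, hQdeg, hQcoeff, hQeval⟩ := exists_eval_mul_eq_prod κ y hs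
  rw [← hQcoeff, ← Nat.add_sub_cancel (2 * m) 1, ← hs, Lagrange.coeff_eq_sum hy]
  · refine sum_congr rfl fun j hj => ?_
    have hQj : Q.eval (y j) = ∏ l ∈ s.erase j, (y j * y l + κ) := by
      refine mul_left_cancel₀ (hκ j hj) ?_
      rw [hQeval j hj, mul_prod_erase s (fun l => y j * y l + κ) hj]
    rw [hQj, ← prod_div_distrib]
    exact prod_congr rfl fun l _ => inv_div _ _
  · rw [hs]
    exact (degree_le_natDegree.trans (Nat.cast_le.2 hQdeg)).trans_lt (Nat.cast_lt.2 (by lia))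

end PartialFractions

section Residues

variable {F K ι : Type*} [Field F] {κ : F}

theorem disjSum_erase_inl {α γ : Type*} [DecidableEq α] [DecidableEq γ] (A : Finset α)
    (B : Finset γ) (a : α) : (A.disjSum B).erase (Sum.inl a) = (A.erase a).disjSum B := by
  ext (x | x) <;> simp

theorem disjSum_erase_inr {α γ : Type*} [DecidableEq α] [DecidableEq γ] (A : Finset α)
    (B : Finset γ) (b : γ) : (A.disjSum B).erase (Sum.inr b) = A.disjSum (B.erase b) := by
  ext (x | x) <;> simp

theorem prod_inv_pairFactor_reflect_right {A : Finset ι} {v : ι → F} (hv : ∀ i ∈ A, v i ≠ 0)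
    (x : F) : ∏ i ∈ A, (pairFactor κ x (-κ / v i))⁻¹ =
      (-κ) ^ #A * ∏ i ∈ A, pairFactor κ x (v i) := by
  rw [prod_congr rfl fun i hi => inv_pairFactor_reflect_right (hv i hi), prod_mul_distrib,
    prod_const]

theorem prod_inv_pairFactor_reflect_left {x : F} (hx : x ≠ 0) (A : Finset ι) (y : ι → F) :
    ∏ i ∈ A, (pairFactor κ (-κ / x) (y i))⁻¹ = (-κ) ^ #A * ∏ i ∈ A, pairFactor κ x (y i) := by
  rw [prod_congr rfl fun i _ => inv_pairFactor_reflect_left hx, prod_mul_distrib, prod_const]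

/-- The nodes of the partial fraction identity: the given points `β`, the poles `u i` of the soliton
factors, and the reflections `-κ / v i` of their zeros. -/
def residueNode (κ : F) (β : K → F) (u v : ι → F) : K ⊕ (ι ⊕ ι) → F :=
  Sum.elim β (Sum.elim u fun i => -κ / v i)

theorem ne_neg_div {x v : F} (hv : v ≠ 0) (h : x * v + κ ≠ 0) : x ≠ -κ / v := fun hx =>
  h (by rw [hx, div_mul_cancel₀ _ hv, neg_add_cancel])

theorem injOn_residueNode [Fintype K] {S : Set F} (hκ : κ ≠ 0)
    (hS : ∀ x ∈ S, ∀ y ∈ S, x * y + κ ≠ 0) {β : K → F} (hβ : Function.Injective β)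
    (hβS : ∀ k, β k ∈ S) {E : Finset ι} {u v : ι → F} (hu : Set.InjOn u E) (hv : Set.InjOn v E)
    (huS : ∀ i ∈ E, u i ∈ S) (hvS : ∀ i ∈ E, v i ∈ S) (hv0 : ∀ i ∈ E, v i ≠ 0)
    (hβu : ∀ k, ∀ i ∈ E, β k ≠ u i) :
    Set.InjOn (residueNode κ β u v) (univ.disjSum (E.disjSum E) : Finset (K ⊕ (ι ⊕ ι))) := by
  have hreflect : ∀ x ∈ S, ∀ i ∈ E, x ≠ -κ / v i := fun x hx i hi =>
    ne_neg_div (hv0 i hi) (hS x hx _ (hvS i hi))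
  rintro (k | i | i) hi (l | j | j) hj h <;>
    simp only [residueNode, Sum.elim_inl, Sum.elim_inr, mem_coe, inr_mem_disjSum,
      inl_mem_disjSum] at h hi hj
  · rw [hβ h]
  · exact absurd h (hβu k j hj)
  · exact absurd h (hreflect _ (hβS k) j hj)
  · exact absurd h.symm (hβu l i hi)
  · rw [hu hi hj h]
  · exact absurd h (hreflect _ (huS i hi) j hj)
  · exact absurd h.symm (hreflect _ (hβS l) i hi)
  · exact absurd h.symm (hreflect _ (huS j hj) i hi)
  · rw [hv hi hj (by simpa [div_eq_mul_inv, hκ] using h)]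

theorem residueNode_mul_self_add_ne_zero [Fintype K] {S : Set F} (hκ : κ ≠ 0)
    (hS : ∀ x ∈ S, ∀ y ∈ S, x * y + κ ≠ 0) {β : K → F} (hβS : ∀ k, β k ∈ S)
    {E : Finset ι} {u v : ι → F} (huS : ∀ i ∈ E, u i ∈ S) (hvS : ∀ i ∈ E, v i ∈ S)
    (hv0 : ∀ i ∈ E, v i ≠ 0) :
    ∀ a ∈ univ.disjSum (E.disjSum E),
      residueNode κ β u v a * residueNode κ β u v a + κ ≠ 0 := by
  rintro (k | i | i) hi <;>
    simp only [residueNode, Sum.elim_inl, Sum.elim_inr, inr_mem_disjSum, inl_mem_disjSum] at hi ⊢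
  · exact hS _ (hβS k) _ (hβS k)
  · exact hS _ (huS i hi) _ (huS i hi)
  · have hvi := hv0 i hi
    have hvv : -κ / v i * (-κ / v i) + κ = κ * (v i * v i + κ) / (v i * v i) := by
      field_simp
      ring
    rw [hvv]
    exact div_ne_zero (mul_ne_zero hκ (hS _ (hvS i hi) _ (hvS i hi))) (mul_ne_zero hvi hvi)

/-- The factor by which a soliton with parameters `(t, s)` acts at the point `x`. Its values at the
zeros of `aₖ` are the ratios `aₖ(t) / aₖ(s)`, and its values at the parameters of another soliton
give the coupling of the two. -/
def solitonFactor (κ t s x : F) : F := pairFactor κ x t / pairFactor κ x s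

theorem prod_solitonFactor (κ : F) (E : Finset ι) (u v : ι → F) (x : F) :
    ∏ i ∈ E, solitonFactor κ (v i) (u i) x =
      (∏ i ∈ E, pairFactor κ x (v i)) * ∏ i ∈ E, (pairFactor κ x (u i))⁻¹ := by
  rw [← prod_mul_distrib]
  exact prod_congr rfl fun i _ => div_eq_mul_inv _ _

theorem prod_inv_pairFactor_reflect [Fintype K] [DecidableEq ι] (hκ : κ ≠ 0) {m : ℕ}
    (hK : Fintype.card K = 2 * m + 1) (β : K → F) {E : Finset ι} (u : ι → F) {v : ι → F}
    (hv0 : ∀ i ∈ E, v i ≠ 0) {j : ι} (hj : j ∈ E) :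
    (∏ k, (pairFactor κ (-κ / v j) (β k))⁻¹) *
      ((∏ i ∈ E, (pairFactor κ (-κ / v j) (u i))⁻¹) *
        ∏ i ∈ E.erase j, (pairFactor κ (-κ / v j) (-κ / v i))⁻¹) =
      (-κ) ^ #E * (pairFactor κ (u j) (v j) * (κ ^ (2 * m + 1) /
        ((∏ i ∈ E.erase j, solitonFactor κ (v i) (u i) (v j)) /
          ∏ k, pairFactor κ (v j) (β k)))) := by
  have hvj := hv0 j hj
  have hpair : ∏ i ∈ E.erase j, (pairFactor κ (-κ / v j) (-κ / v i))⁻¹ =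
      ∏ i ∈ E.erase j, (pairFactor κ (v j) (v i))⁻¹ := prod_congr rfl fun i hi => by
    rw [pairFactor_reflect hκ hvj (hv0 i (mem_of_mem_erase hi))]
  rw [prod_inv_pairFactor_reflect_left hvj, prod_inv_pairFactor_reflect_left hvj, hpair,
    card_univ, hK, ← mul_prod_erase E _ hj, prod_solitonFactor, ← neg_pairFactor κ (u j),
    prod_inv_distrib, prod_inv_distrib, Odd.neg_pow ⟨m, rfl⟩, div_div_eq_mul_div]
  field_simp

theorem sum_residues [Fintype K] [DecidableEq K] [DecidableEq ι] {S : Set F} (hκ : κ ≠ 0)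
    (hS : ∀ x ∈ S, ∀ y ∈ S, x * y + κ ≠ 0)
    {m : ℕ} (hK : Fintype.card K = 2 * m + 1) {β : K → F} (hβ : Function.Injective β)
    (hβS : ∀ k, β k ∈ S) {E : Finset ι} {u v : ι → F} (hu : Set.InjOn u E) (hv : Set.InjOn v E)
    (huS : ∀ i ∈ E, u i ∈ S) (hvS : ∀ i ∈ E, v i ∈ S) (hv0 : ∀ i ∈ E, v i ≠ 0)
    (hβu : ∀ k, ∀ i ∈ E, β k ≠ u i) :
    ∑ k, (∏ l ∈ univ.erase k, (pairFactor κ (β k) (β l))⁻¹) *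
        ∏ i ∈ E, solitonFactor κ (v i) (u i) (β k) +
      ∑ j ∈ E, pairFactor κ (u j) (v j) *
        ((∏ i ∈ E.erase j, solitonFactor κ (v i) (u i) (u j)) / ∏ k, pairFactor κ (u j) (β k) +
          κ ^ (2 * m + 1) / ((∏ i ∈ E.erase j, solitonFactor κ (v i) (u i) (v j)) /
            ∏ k, pairFactor κ (v j) (β k))) =
      (-κ) ^ m := by
  have hcard : #((univ : Finset K).disjSum (E.disjSum E)) = 2 * (m + #E) + 1 := by
    rw [card_disjSum, card_disjSum, card_univ, hK]
    ring
  have key := sum_prod_inv_pairFactor (injOn_residueNode hκ hS hβ hβS hu hv huS hvS hv0 hβu)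
    (residueNode_mul_self_add_ne_zero hκ hS hβS huS hvS hv0) hcard
  simp only [sum_disjSum, disjSum_erase_inl, disjSum_erase_inr, prod_disjSum, residueNode,
    Sum.elim_inl, Sum.elim_inr, prod_inv_pairFactor_reflect_right hv0] at key
  rw [sum_congr rfl fun j hj => prod_inv_pairFactor_reflect hκ hK β u hv0 hj] at key
  refine mul_left_cancel₀ (pow_ne_zero #E (neg_ne_zero.2 hκ)) ?_
  rw [← pow_add, add_comm #E, ← key, mul_add, mul_sum, mul_sum, ← sum_add_distrib]
  refine congrArg₂ _ (sum_congr rfl fun k _ => ?_) (sum_congr rfl fun j hj => ?_)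
  · rw [prod_solitonFactor]
    ring
  · rw [prod_solitonFactor, ← mul_prod_erase E (fun i => pairFactor κ (u j) (v i)) hj,
      prod_inv_distrib (fun k => pairFactor κ (u j) (β k))]
    ring

end Residues

section Subsets

variable {ι M : Type*} [DecidableEq ι]

theorem sum_symmDiff_eq_zero [Fintype ι] [AddCommMonoid M] {f : Finset ι → Finset ι → ι → M}
    (h : ∀ I I' j, j ∉ I → j ∉ I' → f (insert j I) I' j + f I (insert j I') j = 0) :
    ∑ I, ∑ I', ∑ j ∈ I ∆ I', f I I' j = 0 := by
  have hcancel : ∀ I I' j, j ∈ I → j ∉ I' → f I I' j + f (I ∆ {j}) (I' ∆ {j}) j = 0 := by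
    intro I I' j hI hI'
    have hIj : I ∆ {j} = I.erase j := by ext i; by_cases hij : i = j <;> simp_all [mem_symmDiff]
    have hI'j : I' ∆ {j} = insert j I' := by
      ext i; by_cases hij : i = j <;> simp_all [mem_symmDiff]
    rw [hIj, hI'j, ← h (I.erase j) I' j (notMem_erase j I) hI', insert_erase hI]
  simp_rw [sum_sigma']
  refine sum_involution (fun x _ => ⟨x.1 ∆ {x.2.2}, x.2.1 ∆ {x.2.2}, x.2.2⟩) ?_ ?_ ?_ ?_
  · rintro ⟨I, I', j⟩ hj
    simp only [mem_sigma, mem_univ, true_and, mem_symmDiff] at hj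
    rcases hj with ⟨hI, hI'⟩ | ⟨hI', hI⟩
    · exact hcancel I I' j hI hI'
    · have h' := hcancel (I ∆ {j}) (I' ∆ {j}) j (by simp [mem_symmDiff, hI])
        (by simp [mem_symmDiff, hI'])
      rwa [symmDiff_symmDiff_cancel_right, symmDiff_symmDiff_cancel_right, add_comm] at h'
  · rintro ⟨I, I', j⟩ - - heq
    simp only [Sigma.mk.injEq, symmDiff_eq_left, bot_eq_empty, singleton_ne_empty, false_and] at heq
  · rintro ⟨I, I', j⟩ hj
    simp only [mem_sigma, mem_univ, true_and, mem_symmDiff, mem_singleton] at hj ⊢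
    tauto
  · rintro ⟨I, I', j⟩ -
    simp only [symmDiff_symmDiff_cancel_right]

theorem prod_symmDiff_ite_inv [CommGroupWithZero M] (I I' : Finset ι) {g : ι → M}
    (hg : ∀ i ∈ I, i ∈ I' → g i ≠ 0) :
    ∏ i ∈ I ∆ I', (if i ∈ I then g i else (g i)⁻¹) = (∏ i ∈ I, g i) / ∏ i ∈ I', g i := by
  have hinter : ∏ i ∈ I ∩ I', g i ≠ 0 :=
    prod_ne_zero_iff.2 fun i hi => hg i (mem_inter.1 hi).1 (mem_inter.1 hi).2
  rw [symmDiff_def, sup_eq_union, prod_union disjoint_sdiff_sdiff,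
    prod_congr rfl fun i hi => if_pos (mem_sdiff.1 hi).1,
    prod_congr rfl fun i hi => if_neg (mem_sdiff.1 hi).2, prod_inv_distrib, ← div_eq_mul_inv,
    ← prod_inter_mul_prod_sdiff I I' g, ← prod_inter_mul_prod_sdiff I' I g, inter_comm I' I,
    mul_div_mul_left _ _ hinter]

end Subsets

section Tau

variable {R ι : Type*} [CommSemiring R] [LinearOrder ι]

/-- The product of the interactions `B i j` of all pairs `i < j` in `I`. -/
def pairProd (B : ι → ι → R) (I : Finset ι) : R :=
  ∏ i ∈ I, ∏ j ∈ I with i < j, B i j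

/-- The contribution of the set `I` of solitons to the tau function. -/
def weight (B : ι → ι → R) (w : ι → R) (I : Finset ι) : R :=
  (∏ i ∈ I, w i) * pairProd B I

/-- The tau function with one-body weights `w` and pair interactions `B`: the partition function of
a lattice gas on `ι`. -/
def tau [Fintype ι] (B : ι → ι → R) (w : ι → R) : R := ∑ I, weight B w I

theorem pairProd_insert {B : ι → ι → R} (hB : ∀ i j, B i j = B j i) {I : Finset ι} {j : ι}
    (hj : j ∉ I) : pairProd B (insert j I) = pairProd B I * ∏ i ∈ I, B i j := by
  have hrow : ∀ i ∈ I, ∏ l ∈ insert j I with i < l, B i l =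
      (∏ l ∈ I with i < l, B i l) * if i < j then B i j else 1 := fun i _ => by
    rw [prod_filter, prod_insert hj, prod_filter, mul_comm]
  have hnew : ∏ l ∈ insert j I with j < l, B j l = ∏ i ∈ I, if j < i then B i j else 1 := by
    rw [prod_filter, prod_insert hj, if_neg (lt_irrefl j), one_mul]
    exact prod_congr rfl fun i _ => by rw [hB]
  rw [pairProd, prod_insert hj, prod_congr rfl hrow, hnew, prod_mul_distrib, mul_left_comm,
    ← prod_mul_distrib, pairProd]
  refine congrArg _ (prod_congr rfl fun i hi => ?_)
  rcases lt_or_gt_of_ne (ne_of_mem_of_not_mem hi hj) with h | h <;> simp [h, h.not_gt]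

theorem weight_insert {B : ι → ι → R} (hB : ∀ i j, B i j = B j i) (w : ι → R) {I : Finset ι}
    {j : ι} (hj : j ∉ I) :
    weight B w (insert j I) = w j * (∏ i ∈ I, B i j) * weight B w I := by
  rw [weight, prod_insert hj, pairProd_insert hB hj, weight]
  ring

theorem weight_mul (B : ι → ι → R) (w r : ι → R) (I : Finset ι) :
    weight B (fun i => w i * r i) I = weight B w I * ∏ i ∈ I, r i := by
  rw [weight, prod_mul_distrib, weight]
  ring

end Tau

section Parameters

variable {F K ι : Type*}

/-- The nodes `β` together with all soliton parameters. -/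
def points (β : K → F) (t s : ι → F) : Set F := Set.range (Sum.elim β (Sum.elim t s))

theorem node_mem_points (β : K → F) (t s : ι → F) (k : K) : β k ∈ points β t s := ⟨Sum.inl k, rfl⟩

theorem t_mem_points (β : K → F) (t s : ι → F) (i : ι) : t i ∈ points β t s :=
  ⟨Sum.inr (Sum.inl i), rfl⟩

theorem s_mem_points (β : K → F) (t s : ι → F) (i : ι) : s i ∈ points β t s :=
  ⟨Sum.inr (Sum.inr i), rfl⟩

variable [DecidableEq ι] {t s : ι → F}

/-- The pole of the `j`-th factor of `dressing I / dressing I'`, for `j` in exactly one of `I` and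
`I'`; its zero is `pole s t I j`. -/
def pole (t s : ι → F) (I : Finset ι) (j : ι) : F := if j ∈ I then s j else t j

theorem pole_injective (ht : Function.Injective t) (hs : Function.Injective s)
    (hts : ∀ i j, i ≠ j → t i ≠ s j) (I : Finset ι) : Function.Injective (pole t s I) := by
  intro i j hij
  by_contra hne
  unfold pole at hij
  split_ifs at hij
  · exact hne (hs hij)
  · exact hts j i (Ne.symm hne) hij.symm
  · exact hts i j hne hij
  · exact hne (ht hij)

theorem pole_cases (p : F → Prop) (I : Finset ι) {j : ι} (ht : p (t j)) (hs : p (s j)) :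
    p (pole t s I j) := by
  unfold pole
  split_ifs <;> assumption

end Parameters

section Miwa

variable {F K ι : Type*} [Field F] {κ : F} {β : K → F} {t s : ι → F}

/-- The interaction of the solitons `i` and `j`, symmetric in `i` and `j`. -/
def coupling (κ : F) (t s : ι → F) (i j : ι) : F :=
  solitonFactor κ (t i) (s i) (t j) / solitonFactor κ (t i) (s i) (s j)

theorem coupling_comm (κ : F) (t s : ι → F) (i j : ι) :
    coupling κ t s i j = coupling κ t s j i := by
  simp only [coupling, solitonFactor]
  rw [← neg_pairFactor κ (t i) (t j), ← neg_pairFactor κ (s i) (t j),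
    ← neg_pairFactor κ (t i) (s j), ← neg_pairFactor κ (s i) (s j), neg_div_neg_eq, neg_div_neg_eq,
    div_div_div_comm]

/-- The joint effect at `x` of the solitons in `I`. -/
def dressing (κ : F) (t s : ι → F) (I : Finset ι) (x : F) : F :=
  ∏ i ∈ I, solitonFactor κ (t i) (s i) x

theorem prod_coupling (κ : F) (t s : ι → F) (I : Finset ι) (j : ι) :
    ∏ i ∈ I, coupling κ t s i j = dressing κ t s I (t j) / dressing κ t s I (s j) :=
  prod_div_distrib ..

/-- The conditions under which all pair factors in the Miwa equation are finite and the couplings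
are defined. Parameters of different solitons may coincide as long as no `t i` equals an `s j`. -/
structure IsAdmissible (κ : F) (β : K → F) (t s : ι → F) : Prop where
  node_injective : Function.Injective β
  mul_add_ne_zero : ∀ x ∈ points β t s, ∀ y ∈ points β t s, x * y + κ ≠ 0
  t_ne_zero : ∀ i, t i ≠ 0
  s_ne_zero : ∀ i, s i ≠ 0
  node_ne_t : ∀ k i, β k ≠ t i
  node_ne_s : ∀ k i, β k ≠ s i
  t_ne_s : ∀ i j, i ≠ j → t i ≠ s j

/-- Admissible parameters for which the poles appearing in the residue computation are simple. -/
structure IsGeneric (κ : F) (β : K → F) (t s : ι → F) : Prop extends IsAdmissible κ β t s where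
  t_injective : Function.Injective t
  s_injective : Function.Injective s

section Generic

theorem IsAdmissible.solitonFactor_ne_zero (h : IsAdmissible κ β t s) {x : F}
    (hx : x ∈ points β t s) {i : ι} (hxt : x ≠ t i) (hxs : x ≠ s i) :
    solitonFactor κ (t i) (s i) x ≠ 0 :=
  div_ne_zero (pairFactor_ne_zero hxt (h.mul_add_ne_zero x hx _ (t_mem_points β t s i)))
    (pairFactor_ne_zero hxs (h.mul_add_ne_zero x hx _ (s_mem_points β t s i)))

theorem IsGeneric.solitonFactor_t_ne_zero (h : IsGeneric κ β t s) {i j : ι} (hij : i ≠ j) :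
    solitonFactor κ (t i) (s i) (t j) ≠ 0 :=
  h.solitonFactor_ne_zero (t_mem_points β t s j) (h.t_injective.ne hij.symm)
    (h.t_ne_s j i hij.symm)

theorem IsGeneric.solitonFactor_s_ne_zero (h : IsGeneric κ β t s) {i j : ι} (hij : i ≠ j) :
    solitonFactor κ (t i) (s i) (s j) ≠ 0 :=
  h.solitonFactor_ne_zero (s_mem_points β t s j) (h.t_ne_s i j hij).symm
    (h.s_injective.ne hij.symm)

theorem IsGeneric.dressing_t_ne_zero (h : IsGeneric κ β t s) {I : Finset ι} {j : ι} (hj : j ∉ I) :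
    dressing κ t s I (t j) ≠ 0 :=
  prod_ne_zero_iff.2 fun _ hi => h.solitonFactor_t_ne_zero (ne_of_mem_of_not_mem hi hj)

theorem IsGeneric.dressing_s_ne_zero (h : IsGeneric κ β t s) {I : Finset ι} {j : ι} (hj : j ∉ I) :
    dressing κ t s I (s j) ≠ 0 :=
  prod_ne_zero_iff.2 fun _ hi => h.solitonFactor_s_ne_zero (ne_of_mem_of_not_mem hi hj)

variable [DecidableEq ι]

theorem solitonFactor_pole (κ : F) (t s : ι → F) (I : Finset ι) (j : ι) (x : F) :
    solitonFactor κ (pole s t I j) (pole t s I j) x =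
      if j ∈ I then solitonFactor κ (t j) (s j) x else (solitonFactor κ (t j) (s j) x)⁻¹ := by
  by_cases hj : j ∈ I <;> simp only [pole, hj, if_true, if_false, solitonFactor, inv_div]

theorem prod_symmDiff_solitonFactor_pole {I I' : Finset ι} {x : F}
    (hx : ∀ i ∈ I, i ∈ I' → solitonFactor κ (t i) (s i) x ≠ 0) :
    ∏ i ∈ I ∆ I', solitonFactor κ (pole s t I i) (pole t s I i) x =
      dressing κ t s I x / dressing κ t s I' x := by
  rw [prod_congr rfl fun i _ => solitonFactor_pole κ t s I i x]
  exact prod_symmDiff_ite_inv I I' hx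

theorem prod_symmDiff_erase_solitonFactor_pole {I I' : Finset ι} {j : ι} {x : F}
    (hx : ∀ i, i ≠ j → solitonFactor κ (t i) (s i) x ≠ 0) :
    ∏ i ∈ (I ∆ I').erase j, solitonFactor κ (pole s t I i) (pole t s I i) x =
      dressing κ t s (I.erase j) x / dressing κ t s (I'.erase j) x := by
  have herase : (I ∆ I').erase j = I.erase j ∆ I'.erase j := by
    ext i
    simp only [mem_erase, mem_symmDiff]
    tauto
  rw [← prod_symmDiff_solitonFactor_pole fun i hi _ => hx i (mem_erase.1 hi).1, ← herase]
  refine prod_congr rfl fun i hi => ?_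
  have hij := (mem_erase.1 hi).1
  simp only [solitonFactor_pole, mem_erase, ne_eq, hij, not_false_eq_true, true_and]

variable [Fintype K]

/-- The quotient of the dressings by `I` and `I'`, divided by the pair factors with the nodes. -/
def dressingQuotient (κ : F) (β : K → F) (t s : ι → F) (I I' : Finset ι) (x : F) : F :=
  dressing κ t s I x / dressing κ t s I' x / ∏ k, pairFactor κ x (β k)

/-- The contribution of the `j`-th soliton, which belongs to exactly one of `I` and `I'`, to the
partial fraction identity for `dressing I / dressing I'`. -/
def residue (κ : F) (β : K → F) (t s : ι → F) (I I' : Finset ι) (j : ι) : F :=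
  pairFactor κ (pole t s I j) (pole s t I j) *
    (dressingQuotient κ β t s (I.erase j) (I'.erase j) (pole t s I j) +
      κ ^ Fintype.card K / dressingQuotient κ β t s (I.erase j) (I'.erase j) (pole s t I j))

theorem IsGeneric.sum_dressing_add_sum_residue [DecidableEq K] (h : IsGeneric κ β t s)
    (hκ : κ ≠ 0) {m : ℕ} (hK : Fintype.card K = 2 * m + 1) (I I' : Finset ι) :
    ∑ k, (∏ l ∈ univ.erase k, (pairFactor κ (β k) (β l))⁻¹) *
        (dressing κ t s I (β k) / dressing κ t s I' (β k)) +
      ∑ j ∈ I ∆ I', residue κ β t s I I' j = (-κ) ^ m := by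
  have hst : ∀ i j, i ≠ j → s i ≠ t j := fun i j hij => (h.t_ne_s j i hij.symm).symm
  rw [← sum_residues hκ h.mul_add_ne_zero hK h.node_injective (node_mem_points β t s)
    (pole_injective h.t_injective h.s_injective h.t_ne_s I).injOn
    (pole_injective h.s_injective h.t_injective hst I).injOn
    (fun i _ => pole_cases (· ∈ points β t s) I (t_mem_points β t s i) (s_mem_points β t s i))
    (fun i _ => pole_cases (· ∈ points β t s) I (s_mem_points β t s i) (t_mem_points β t s i))
    (fun i _ => pole_cases (· ≠ 0) I (h.s_ne_zero i) (h.t_ne_zero i))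
    (fun k i _ => pole_cases (β k ≠ ·) I (h.node_ne_t k i) (h.node_ne_s k i))]
  refine congrArg₂ _ (sum_congr rfl fun k _ => ?_) (sum_congr rfl fun j _ => ?_)
  · rw [prod_symmDiff_solitonFactor_pole fun i _ _ => h.solitonFactor_ne_zero
      (node_mem_points β t s k) (h.node_ne_t k i) (h.node_ne_s k i)]
  · have hpole : ∀ (t' s' : ι → F), (∀ p : F → Prop, p (t j) → p (s j) → p (pole t' s' I j)) →
        ∏ i ∈ (I ∆ I').erase j, solitonFactor κ (pole s t I i) (pole t s I i) (pole t' s' I j) =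
          dressing κ t s (I.erase j) (pole t' s' I j) /
            dressing κ t s (I'.erase j) (pole t' s' I j) := fun t' s' hp =>
      prod_symmDiff_erase_solitonFactor_pole fun i hi =>
        hp (solitonFactor κ (t i) (s i) · ≠ 0) (h.solitonFactor_t_ne_zero hi)
          (h.solitonFactor_s_ne_zero hi)
    rw [hpole t s fun p => pole_cases p I, hpole s t fun p ht hs => pole_cases p I hs ht, residue,
      hK, dressingQuotient, dressingQuotient]

end Generic

section Exchange

variable [Fintype K] [LinearOrder ι]

/-- Moving the soliton `j` from one factor of a product of two tau functions to the other. -/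
theorem IsGeneric.weight_insert_mul_dressingQuotient (h : IsGeneric κ β t s) (w : ι → F)
    {I I' : Finset ι} {j : ι} (hI : j ∉ I) (hI' : j ∉ I') :
    weight (coupling κ t s) w (insert j I) *
        weight (coupling κ t s) (fun i => w i * ∏ k, solitonFactor κ (t i) (s i) (β k)) I' *
        dressingQuotient κ β t s I I' (s j) =
      weight (coupling κ t s) w I *
        weight (coupling κ t s) (fun i => w i * ∏ k, solitonFactor κ (t i) (s i) (β k))
          (insert j I') *
        dressingQuotient κ β t s I I' (t j) := by
  have hnode : ∏ k, solitonFactor κ (t j) (s j) (β k) =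
      (∏ k, pairFactor κ (t j) (β k)) / ∏ k, pairFactor κ (s j) (β k) := by
    rw [← prod_div_distrib]
    refine prod_congr rfl fun k _ => ?_
    rw [solitonFactor, ← neg_pairFactor κ (t j), ← neg_pairFactor κ (s j), neg_div_neg_eq]
  have hGt : ∏ k, pairFactor κ (t j) (β k) ≠ 0 := prod_ne_zero_iff.2 fun k _ =>
    pairFactor_ne_zero (h.node_ne_t k j).symm
      (h.mul_add_ne_zero _ (t_mem_points β t s j) _ (node_mem_points β t s k))
  have hIs := h.dressing_s_ne_zero hI
  have hI't := h.dressing_t_ne_zero hI'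
  simp only [weight_insert (coupling_comm κ t s) _ hI, weight_insert (coupling_comm κ t s) _ hI',
    prod_coupling, hnode, dressingQuotient]
  field_simp

theorem IsGeneric.weight_mul_residue_cancel (h : IsGeneric κ β t s) (w : ι → F)
    {I I' : Finset ι} {j : ι} (hI : j ∉ I) (hI' : j ∉ I') :
    weight (coupling κ t s) w (insert j I) *
        weight (coupling κ t s) (fun i => w i * ∏ k, solitonFactor κ (t i) (s i) (β k)) I' *
        residue κ β t s (insert j I) I' j +
      weight (coupling κ t s) w I *
        weight (coupling κ t s) (fun i => w i * ∏ k, solitonFactor κ (t i) (s i) (β k))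
          (insert j I') *
        residue κ β t s I (insert j I') j = 0 := by
  have hexchange := h.weight_insert_mul_dressingQuotient w hI hI'
  have hQ : ∀ x ∈ points β t s, (∀ k, β k ≠ x) → dressing κ t s I x ≠ 0 →
      dressing κ t s I' x ≠ 0 → dressingQuotient κ β t s I I' x ≠ 0 := fun x hx hβx hIx hI'x =>
    div_ne_zero (div_ne_zero hIx hI'x) (prod_ne_zero_iff.2 fun k _ =>
      pairFactor_ne_zero (hβx k).symm (h.mul_add_ne_zero _ hx _ (node_mem_points β t s k)))
  have hQt := hQ _ (t_mem_points β t s j) (h.node_ne_t · j) (h.dressing_t_ne_zero hI)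
    (h.dressing_t_ne_zero hI')
  have hQs := hQ _ (s_mem_points β t s j) (h.node_ne_s · j) (h.dressing_s_ne_zero hI)
    (h.dressing_s_ne_zero hI')
  simp only [residue, pole, mem_insert_self, hI, if_true, if_false, erase_insert hI,
    erase_insert hI', erase_eq_of_notMem hI, erase_eq_of_notMem hI']
  rw [← neg_pairFactor κ (s j)]
  generalize dressingQuotient κ β t s I I' (t j) = Qt at *
  generalize dressingQuotient κ β t s I I' (s j) = Qs at *
  field_simp
  linear_combination (pairFactor κ (s j) (t j)) * (Qs * Qt + κ ^ Fintype.card K) * hexchange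

variable [Fintype ι] [DecidableEq K]

theorem IsGeneric.miwa (h : IsGeneric κ β t s) (hκ : κ ≠ 0) {m : ℕ}
    (hK : Fintype.card K = 2 * m + 1) (w : ι → F) :
    ∑ k, (∏ l ∈ univ.erase k, (pairFactor κ (β k) (β l))⁻¹) *
        (tau (coupling κ t s) (fun i => w i * solitonFactor κ (t i) (s i) (β k)) *
          tau (coupling κ t s) fun i =>
            w i * ∏ l ∈ univ.erase k, solitonFactor κ (t i) (s i) (β l)) =
      (-κ) ^ m * (tau (coupling κ t s) w *
        tau (coupling κ t s) fun i => w i * ∏ k, solitonFactor κ (t i) (s i) (β k)) := by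
  set C := coupling κ t s
  set W := weight C w
  set W' := weight C fun i => w i * ∏ k, solitonFactor κ (t i) (s i) (β k)
  have hW : ∀ k I, weight C (fun i => w i * solitonFactor κ (t i) (s i) (β k)) I =
      W I * dressing κ t s I (β k) := fun k I => weight_mul ..
  have hW' : ∀ k I', weight C (fun i => w i * ∏ l ∈ univ.erase k, solitonFactor κ (t i) (s i) (β l))
      I' = W' I' / dressing κ t s I' (β k) := by
    intro k I'
    have hdressing : dressing κ t s I' (β k) ≠ 0 := prod_ne_zero_iff.2 fun i _ =>
      h.solitonFactor_ne_zero (node_mem_points β t s k) (h.node_ne_t k i) (h.node_ne_s k i)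
    rw [eq_div_iff hdressing, dressing, ← weight_mul]
    simp only [mul_assoc, prod_erase_mul _ _ (mem_univ k), W']
  have hpair : ∀ I I', W I * W' I' * (-κ) ^ m =
      ∑ k, (∏ l ∈ univ.erase k, (pairFactor κ (β k) (β l))⁻¹) *
          (W I * dressing κ t s I (β k) * (W' I' / dressing κ t s I' (β k))) +
        ∑ j ∈ I ∆ I', W I * W' I' * residue κ β t s I I' j := by
    intro I I'
    rw [← h.sum_dressing_add_sum_residue hκ hK I I', mul_add, mul_sum, mul_sum]
    exact congrArg (· + _) (sum_congr rfl fun k _ => by ring)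
  have hresidues : ∑ I, ∑ I', ∑ j ∈ I ∆ I', W I * W' I' * residue κ β t s I I' j = 0 :=
    sum_symmDiff_eq_zero fun I I' j hI hI' => h.weight_mul_residue_cancel w hI hI'
  simp only [tau, sum_mul_sum, hW, hW']
  simp only [mul_sum]
  rw [sum_comm, sum_congr rfl fun I _ => sum_comm, ← add_zero (∑ I, _), ← hresidues,
    ← sum_add_distrib]
  refine sum_congr rfl fun I _ => ?_
  rw [← sum_add_distrib]
  refine sum_congr rfl fun I' _ => ?_
  rw [mul_comm ((-κ) ^ m), hpair]

end Exchange

end Miwa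

section Perturbation

variable {X 𝕜 K ι : Type*} [TopologicalSpace X] [NormedField 𝕜] {κ : 𝕜} {β : K → 𝕜}
  {t s : X → ι → 𝕜} {x₀ : X}

theorem IsAdmissible.eventually [Finite K] [Finite ι] (h : IsAdmissible κ β (t x₀) (s x₀))
    (ht : ∀ i, ContinuousAt (t · i) x₀) (hs : ∀ i, ContinuousAt (s · i) x₀) :
    ∀ᶠ x in 𝓝 x₀, IsAdmissible κ β (t x) (s x) := by
  have hne : ∀ {f g : X → 𝕜}, ContinuousAt f x₀ → ContinuousAt g x₀ → f x₀ ≠ g x₀ →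
      ∀ᶠ x in 𝓝 x₀, f x ≠ g x := fun hf hg => (hf.ne_iff_eventually_ne hg).1
  have hpoint : ∀ a, ContinuousAt (fun x => Sum.elim β (Sum.elim (t x) (s x)) a) x₀ := by
    rintro (k | i | i)
    exacts [continuousAt_const, ht i, hs i]
  filter_upwards [eventually_all.2 fun a => eventually_all.2 fun a' =>
      hne (((hpoint a).mul (hpoint a')).add_const κ) continuousAt_const
        (h.mul_add_ne_zero _ ⟨a, rfl⟩ _ ⟨a', rfl⟩),
    eventually_all.2 fun i => hne (ht i) continuousAt_const (h.t_ne_zero i),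
    eventually_all.2 fun i => hne (hs i) continuousAt_const (h.s_ne_zero i),
    eventually_all.2 fun k => eventually_all.2 fun i =>
      hne continuousAt_const (ht i) (h.node_ne_t k i),
    eventually_all.2 fun k => eventually_all.2 fun i =>
      hne continuousAt_const (hs i) (h.node_ne_s k i),
    eventually_all.2 fun i => eventually_all.2 fun j => eventually_imp_distrib_left.2 fun hij =>
      hne (ht i) (hs j) (h.t_ne_s i j hij)]
    with x hmul ht0 hs0 hβt hβs hts
  exact ⟨h.node_injective, Set.forall_mem_range.2 fun a => Set.forall_mem_range.2 (hmul a),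
    ht0, hs0, hβt, hβs, hts⟩

theorem IsAdmissible.continuousAt_pairFactor (h : IsAdmissible κ β (t x₀) (s x₀)) {f g : X → 𝕜}
    (hf : ContinuousAt f x₀) (hg : ContinuousAt g x₀) (hf₀ : f x₀ ∈ points β (t x₀) (s x₀))
    (hg₀ : g x₀ ∈ points β (t x₀) (s x₀)) :
    ContinuousAt (fun x => pairFactor κ (f x) (g x)) x₀ :=
  (hf.sub hg).div ((hf.mul hg).add continuousAt_const) (h.mul_add_ne_zero _ hf₀ _ hg₀)

theorem IsAdmissible.continuousAt_solitonFactor (h : IsAdmissible κ β (t x₀) (s x₀))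
    {i : ι} (ht : ContinuousAt (t · i) x₀) (hs : ContinuousAt (s · i) x₀) {f : X → 𝕜}
    (hf : ContinuousAt f x₀) (hf₀ : f x₀ ∈ points β (t x₀) (s x₀)) (hfs : f x₀ ≠ s x₀ i) :
    ContinuousAt (fun x => solitonFactor κ (t x i) (s x i) (f x)) x₀ :=
  (h.continuousAt_pairFactor hf ht hf₀ (t_mem_points ..)).div
    (h.continuousAt_pairFactor hf hs hf₀ (s_mem_points ..))
    (pairFactor_ne_zero hfs (h.mul_add_ne_zero _ hf₀ _ (s_mem_points ..)))

theorem IsAdmissible.continuousAt_coupling (h : IsAdmissible κ β (t x₀) (s x₀))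
    (ht : ∀ i, ContinuousAt (t · i) x₀) (hs : ∀ i, ContinuousAt (s · i) x₀) {i j : ι}
    (hij : i ≠ j) : ContinuousAt (fun x => coupling κ (t x) (s x) i j) x₀ := by
  have hti := t_mem_points β (t x₀) (s x₀)
  have hsi := s_mem_points β (t x₀) (s x₀)
  simp only [coupling, solitonFactor, div_div_div_eq]
  exact ((h.continuousAt_pairFactor (ht j) (ht i) (hti j) (hti i)).mul
    (h.continuousAt_pairFactor (hs j) (hs i) (hsi j) (hsi i))).div
    ((h.continuousAt_pairFactor (ht j) (hs i) (hti j) (hsi i)).mul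
      (h.continuousAt_pairFactor (hs j) (ht i) (hsi j) (hti i)))
    (mul_ne_zero
      (pairFactor_ne_zero (h.t_ne_s j i hij.symm) (h.mul_add_ne_zero _ (hti j) _ (hsi i)))
      (pairFactor_ne_zero (h.t_ne_s i j hij).symm (h.mul_add_ne_zero _ (hsi j) _ (hti i))))

theorem continuousAt_tau [LinearOrder ι] [Fintype ι] {B : X → ι → ι → 𝕜} {w : X → ι → 𝕜}
    (hB : ∀ i j, i ≠ j → ContinuousAt (B · i j) x₀) (hw : ∀ i, ContinuousAt (w · i) x₀) :
    ContinuousAt (fun x => tau (B x) (w x)) x₀ :=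
  tendsto_finsetSum _ fun _ _ => (tendsto_finsetProd _ fun i _ => hw i).mul <|
    tendsto_finsetProd _ fun i _ => tendsto_finsetProd _ fun j hj =>
      hB i j (mem_filter.1 hj).2.ne

theorem IsAdmissible.continuousAt_tau_coupling [LinearOrder ι] [Fintype ι]
    (h : IsAdmissible κ β (t x₀) (s x₀)) (ht : ∀ i, ContinuousAt (t · i) x₀)
    (hs : ∀ i, ContinuousAt (s · i) x₀) (w : ι → 𝕜) (E : Finset K) :
    ContinuousAt (fun x => tau (coupling κ (t x) (s x)) fun i =>
      w i * ∏ k ∈ E, solitonFactor κ (t x i) (s x i) (β k)) x₀ :=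
  continuousAt_tau (fun _ _ => h.continuousAt_coupling ht hs) fun i =>
    continuousAt_const.mul <| tendsto_finsetProd _ fun k _ =>
      h.continuousAt_solitonFactor (ht i) (hs i) continuousAt_const (node_mem_points ..)
        (h.node_ne_s k i)

end Perturbation

section Coinciding

variable {𝕜 K ι : Type*} [NontriviallyNormedField 𝕜] {κ : 𝕜} {β : K → 𝕜} {t s : ι → 𝕜}

theorem eventually_injective_add_smul [Finite ι] (t : ι → 𝕜) {v : ι → 𝕜}
    (hv : Function.Injective v) : ∀ᶠ ε in 𝓝[≠] (0 : 𝕜), Function.Injective (t + ε • v) := by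
  have hne : ∀ i j, ∀ᶠ ε in 𝓝[≠] (0 : 𝕜), i ≠ j → (t + ε • v) i ≠ (t + ε • v) j := by
    intro i j
    simp only [Pi.add_apply, Pi.smul_apply, smul_eq_mul]
    rcases eq_or_ne (t i) (t j) with htij | htij
    · filter_upwards [self_mem_nhdsWithin] with ε hε hij h
      rw [htij] at h
      exact hij (hv (mul_left_cancel₀ hε (add_left_cancel h)))
    · have hline : ∀ l, ContinuousAt (fun ε : 𝕜 => t l + ε * v l) 0 := fun l => by fun_prop
      refine (((hline i).ne_iff_eventually_ne (hline j)).1 ?_).filter_mono nhdsWithin_le_nhds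
        |>.mono fun _ hε _ => hε
      simpa only [zero_mul, add_zero] using htij
  filter_upwards [eventually_all.2 fun i => eventually_all.2 (hne i)] with ε hε i j
  exact not_imp_not.1 (hε i j)

theorem IsAdmissible.miwa [LinearOrder ι] [Fintype ι] [Fintype K] [DecidableEq K]
    (h : IsAdmissible κ β t s) (hκ : κ ≠ 0) {m : ℕ} (hK : Fintype.card K = 2 * m + 1)
    (w : ι → 𝕜) :
    ∑ k, (∏ l ∈ univ.erase k, (pairFactor κ (β k) (β l))⁻¹) *
        (tau (coupling κ t s) (fun i => w i * solitonFactor κ (t i) (s i) (β k)) *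
          tau (coupling κ t s) fun i =>
            w i * ∏ l ∈ univ.erase k, solitonFactor κ (t i) (s i) (β l)) =
      (-κ) ^ m * (tau (coupling κ t s) w *
        tau (coupling κ t s) fun i => w i * ∏ k, solitonFactor κ (t i) (s i) (β k)) := by
  let v : ι ↪ 𝕜 := (Fintype.equivFin ι).toEmbedding.trans
    (Fin.valEmbedding.trans (Infinite.natEmbedding 𝕜))
  let T : 𝕜 → ι → 𝕜 := fun ε => t + ε • v
  let S : 𝕜 → ι → 𝕜 := fun ε => s + ε • v
  have hT₀ : T 0 = t := by simp only [T, zero_smul, add_zero]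
  have hS₀ : S 0 = s := by simp only [S, zero_smul, add_zero]
  have hT : ∀ i, ContinuousAt (T · i) 0 := fun i => by fun_prop
  have hS : ∀ i, ContinuousAt (S · i) 0 := fun i => by fun_prop
  have h₀ : IsAdmissible κ β (T 0) (S 0) := by rwa [hT₀, hS₀]
  have hgeneric : ∀ᶠ ε in 𝓝[≠] 0, IsGeneric κ β (T ε) (S ε) := by
    filter_upwards [(h₀.eventually hT hS).filter_mono nhdsWithin_le_nhds,
      eventually_injective_add_smul t v.injective, eventually_injective_add_smul s v.injective]
      with ε hε ht hs using ⟨hε, ht, hs⟩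
  let τ : Finset K → 𝕜 → 𝕜 := fun E ε => tau (coupling κ (T ε) (S ε)) fun i =>
    w i * ∏ k ∈ E, solitonFactor κ (T ε i) (S ε i) (β k)
  have hτ : ∀ E, Tendsto (τ E) (𝓝[≠] 0) (𝓝 (τ E 0)) := fun E =>
    (h₀.continuousAt_tau_coupling hT hS w E).mono_left nhdsWithin_le_nhds
  have hlimit : ∑ k, (∏ l ∈ univ.erase k, (pairFactor κ (β k) (β l))⁻¹) *
      (τ {k} 0 * τ (univ.erase k) 0) = (-κ) ^ m * (τ ∅ 0 * τ univ 0) := by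
    refine tendsto_nhds_unique_of_eventuallyEq
      (tendsto_finsetSum _ fun k _ => ((hτ {k}).mul (hτ (univ.erase k))).const_mul _)
      (((hτ ∅).mul (hτ univ)).const_mul _) ?_
    filter_upwards [hgeneric] with ε hε
    simpa only [τ, prod_singleton, prod_empty, mul_one] using hε.miwa hκ hK w
  simpa only [τ, hT₀, hS₀, prod_singleton, prod_empty, mul_one] using hlimit

end Coinciding

section Solution

variable {d₁ d₂ : ℝ} {N : ℕ} {c t s : Fin N → ℝ}

/-- The constant `κ` for which `cf` is a multiple of `pairFactor κ`. -/
noncomputable def modulus (d₁ d₂ : ℝ) : ℝ := z₁ d₁ d₂ * z₂ d₁ d₂ * z₄ d₁ d₂ / z₃ d₁ d₂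

/-- The zeros of `a₁`, `a₂`, `a₃`, indexed from `0`. They are the Miwa nodes of the equation: the
soliton factor at the zero of `aₖ` is `aₖ t / aₖ s`. -/
noncomputable def node (d₁ d₂ : ℝ) : Fin 3 → ℝ :=
  ![-(z₂ d₁ d₂ * z₄ d₁ d₂ / z₃ d₁ d₂), z₁ d₁ d₂ * z₄ d₁ d₂ / z₃ d₁ d₂, 0]

/-- A positive real that is neither a pole of `a₁` nor a zero of `a₂`. -/
structure IsRegularPoint (d₁ d₂ x : ℝ) : Prop where
  pos : 0 < x
  ne_z₁ : x ≠ z₁ d₁ d₂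
  ne_node : x ≠ node d₁ d₂ 1

theorem modulus_pos (hd₁ : 0 < d₁) (hd₂ : 0 < d₂) (hd₂' : d₂ < 1) : 0 < modulus d₁ d₂ := by
  have : 0 < 1 - d₂ := sub_pos.2 hd₂'
  simp only [modulus, z₁, z₂, z₃, z₄]
  positivity

theorem z₁_lt_node_one (hd₁ : 0 < d₁) (hd₂ : 0 < d₂) (hd₂' : d₂ < 1) :
    z₁ d₁ d₂ < node d₁ d₂ 1 := by
  simp only [node, Matrix.cons_val, z₁, z₃, z₄]
  rw [lt_div_iff₀ (sub_pos.2 hd₂')]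
  exact mul_lt_mul_of_pos_left (by linarith) hd₁

theorem cf_eq_pairFactor_div (hd₂' : d₂ < 1) (x y : ℝ) :
    cf d₁ d₂ x y = pairFactor (modulus d₁ d₂) x y / z₃ d₁ d₂ := by
  have hz₃ : z₃ d₁ d₂ ≠ 0 := (sub_pos.2 hd₂').ne'
  rw [cf, pairFactor, div_div, add_mul, modulus, div_mul_cancel₀ _ hz₃]

theorem b_eq_coupling (hd₂' : d₂ < 1) (t s : Fin N → ℝ) (i j : Fin N) :
    b d₁ d₂ (t i) (s i) (t j) (s j) = coupling (modulus d₁ d₂) t s i j := by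
  have hz₃ : z₃ d₁ d₂ ≠ 0 := (sub_pos.2 hd₂').ne'
  simp only [b, cf_eq_pairFactor_div hd₂', coupling, solitonFactor,
    ← neg_pairFactor _ (t i), ← neg_pairFactor _ (s i), neg_div_neg_eq]
  rw [div_mul_div_comm, div_mul_div_comm, div_div_div_cancel_right₀ (mul_ne_zero hz₃ hz₃),
    div_div_div_eq]

theorem node_zero_mul_add_modulus (d₁ d₂ x : ℝ) : node d₁ d₂ 0 * x + modulus d₁ d₂ =
    (z₁ d₁ d₂ - x) * (z₂ d₁ d₂ * z₄ d₁ d₂) / z₃ d₁ d₂ := by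
  simp only [node, modulus, Matrix.cons_val]; ring

theorem node_one_mul_add_modulus (d₁ d₂ x : ℝ) : node d₁ d₂ 1 * x + modulus d₁ d₂ =
    (z₂ d₁ d₂ + x) * (z₁ d₁ d₂ * z₄ d₁ d₂) / z₃ d₁ d₂ := by
  simp only [node, modulus, Matrix.cons_val]; ring

theorem node_mul_add_modulus_ne_zero (hd₁ : 0 < d₁) (hd₂ : 0 < d₂) (hd₂' : d₂ < 1) {x : ℝ}
    (h₁ : x ≠ z₁ d₁ d₂) (h₂ : x ≠ -z₂ d₁ d₂) (k : Fin 3) :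
    node d₁ d₂ k * x + modulus d₁ d₂ ≠ 0 := by
  have hz₃ : z₃ d₁ d₂ ≠ 0 := (sub_pos.2 hd₂').ne'
  have hz₄ : z₄ d₁ d₂ ≠ 0 := (add_pos one_pos hd₁).ne'
  match k with
  | 0 =>
    rw [node_zero_mul_add_modulus]
    exact div_ne_zero (mul_ne_zero (sub_ne_zero.2 h₁.symm) (mul_ne_zero hd₂.ne' hz₄)) hz₃
  | 1 =>
    rw [node_one_mul_add_modulus]
    exact div_ne_zero (mul_ne_zero (fun h => h₂ (eq_neg_of_add_eq_zero_right h))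
      (mul_ne_zero hd₁.ne' hz₄)) hz₃
  | 2 =>
    rw [show node d₁ d₂ 2 = 0 from rfl, zero_mul, zero_add]
    exact (modulus_pos hd₁ hd₂ hd₂').ne'

theorem pairFactor_node_zero (hd₂' : d₂ < 1) (x : ℝ) :
    pairFactor (modulus d₁ d₂) (node d₁ d₂ 0) x = -a₁ d₁ d₂ x / (z₂ d₁ d₂ * z₄ d₁ d₂) := by
  have hz₃ : z₃ d₁ d₂ ≠ 0 := (sub_pos.2 hd₂').ne'
  have hnum : node d₁ d₂ 0 - x = -(z₂ d₁ d₂ * z₄ d₁ d₂ + z₃ d₁ d₂ * x) / z₃ d₁ d₂ := by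
    simp only [node, Matrix.cons_val]; field_simp; ring
  rw [pairFactor, hnum, node_zero_mul_add_modulus, div_div_div_cancel_right₀ hz₃, a₁, ← div_div,
    neg_div]

theorem pairFactor_node_one (hd₂' : d₂ < 1) (x : ℝ) :
    pairFactor (modulus d₁ d₂) (node d₁ d₂ 1) x = a₂ d₁ d₂ x / (z₁ d₁ d₂ * z₄ d₁ d₂) := by
  have hz₃ : z₃ d₁ d₂ ≠ 0 := (sub_pos.2 hd₂').ne'
  have hnum : node d₁ d₂ 1 - x = (z₁ d₁ d₂ * z₄ d₁ d₂ - z₃ d₁ d₂ * x) / z₃ d₁ d₂ := by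
    simp only [node, Matrix.cons_val]; field_simp
  rw [pairFactor, hnum, node_one_mul_add_modulus, div_div_div_cancel_right₀ hz₃, a₂, ← div_div]

theorem pairFactor_node_two (d₁ d₂ x : ℝ) :
    pairFactor (modulus d₁ d₂) (node d₁ d₂ 2) x = -a₃ d₁ d₂ x / modulus d₁ d₂ := by
  simp only [pairFactor, node, Matrix.cons_val, a₃, zero_mul, zero_add, zero_sub]

theorem solitonFactor_node_zero (hd₁ : 0 < d₁) (hd₂ : 0 < d₂) (hd₂' : d₂ < 1) (x y : ℝ) :
    solitonFactor (modulus d₁ d₂) x y (node d₁ d₂ 0) = a₁ d₁ d₂ x / a₁ d₁ d₂ y := by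
  have hz : z₂ d₁ d₂ * z₄ d₁ d₂ ≠ 0 := (mul_pos hd₂ (add_pos one_pos hd₁)).ne'
  rw [solitonFactor, pairFactor_node_zero hd₂', pairFactor_node_zero hd₂',
    div_div_div_cancel_right₀ hz, neg_div_neg_eq]

theorem solitonFactor_node_one (hd₁ : 0 < d₁) (hd₂' : d₂ < 1) (x y : ℝ) :
    solitonFactor (modulus d₁ d₂) x y (node d₁ d₂ 1) = a₂ d₁ d₂ x / a₂ d₁ d₂ y := by
  have hz : z₁ d₁ d₂ * z₄ d₁ d₂ ≠ 0 := (mul_pos hd₁ (add_pos one_pos hd₁)).ne'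
  rw [solitonFactor, pairFactor_node_one hd₂', pairFactor_node_one hd₂',
    div_div_div_cancel_right₀ hz]

theorem solitonFactor_node_two (hd₁ : 0 < d₁) (hd₂ : 0 < d₂) (hd₂' : d₂ < 1) (x y : ℝ) :
    solitonFactor (modulus d₁ d₂) x y (node d₁ d₂ 2) = a₃ d₁ d₂ x / a₃ d₁ d₂ y := by
  rw [solitonFactor, pairFactor_node_two, pairFactor_node_two,
    div_div_div_cancel_right₀ (modulus_pos hd₁ hd₂ hd₂').ne', neg_div_neg_eq]

theorem pairFactor_node_zero_node_one (hd₁ : 0 < d₁) (hd₂ : 0 < d₂) (hd₂' : d₂ < 1) :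
    pairFactor (modulus d₁ d₂) (node d₁ d₂ 0) (node d₁ d₂ 1) = z₄ d₁ d₂ / modulus d₁ d₂ := by
  have hz₃ : 1 - d₂ ≠ 0 := (sub_pos.2 hd₂').ne'
  have hz₄ : 1 + d₁ ≠ 0 := (add_pos one_pos hd₁).ne'
  have hne : 1 - d₂ - (1 + d₁) ≠ 0 := by linarith
  rw [pairFactor_node_zero hd₂', a₁]
  simp only [node, modulus, Matrix.cons_val, z₁, z₂, z₃, z₄]
  field_simp
  ring

theorem prod_inv_pairFactor_node (hd₁ : 0 < d₁) (hd₂ : 0 < d₂) (hd₂' : d₂ < 1) (k : Fin 3) :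
    ∏ l ∈ univ.erase k, (pairFactor (modulus d₁ d₂) (node d₁ d₂ k) (node d₁ d₂ l))⁻¹ =
      -modulus d₁ d₂ * (![z₁ d₁ d₂, z₂ d₁ d₂, z₃ d₁ d₂] k / z₄ d₁ d₂) := by
  have hz₃ : 1 - d₂ ≠ 0 := (sub_pos.2 hd₂').ne'
  have hz₄ : 1 + d₁ ≠ 0 := (add_pos one_pos hd₁).ne'
  have h₀₁ := pairFactor_node_zero_node_one hd₁ hd₂ hd₂'
  have h₂ := pairFactor_node_two d₁ d₂
  match k with
  | 0 =>
    rw [show univ.erase (0 : Fin 3) = {1, 2} from rfl, prod_pair (by decide), h₀₁,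
      ← neg_pairFactor _ (node d₁ d₂ 2), h₂]
    simp only [node, modulus, a₃, Matrix.cons_val, z₁, z₂, z₃, z₄]
    field_simp
  | 1 =>
    rw [show univ.erase (1 : Fin 3) = {0, 2} from rfl, prod_pair (by decide),
      ← neg_pairFactor _ (node d₁ d₂ 0), ← neg_pairFactor _ (node d₁ d₂ 2), h₀₁, h₂]
    simp only [node, modulus, a₃, Matrix.cons_val, z₁, z₂, z₃, z₄]
    field_simp
  | 2 =>
    rw [show univ.erase (2 : Fin 3) = {0, 1} from rfl, prod_pair (by decide), h₂, h₂]
    simp only [node, modulus, a₃, Matrix.cons_val, z₁, z₂, z₃, z₄]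
    field_simp

theorem node_zero_lt (hd₁ : 0 < d₁) (hd₂ : 0 < d₂) (hd₂' : d₂ < 1) :
    node d₁ d₂ 0 < -z₂ d₁ d₂ := by
  simp only [node, Matrix.cons_val, z₂, z₃, z₄]
  rw [neg_lt_neg_iff, lt_div_iff₀ (sub_pos.2 hd₂')]
  exact mul_lt_mul_of_pos_left (by linarith) hd₂

theorem IsRegularPoint.node_ne (hd₁ : 0 < d₁) (hd₂ : 0 < d₂) (hd₂' : d₂ < 1) {x : ℝ}
    (hx : IsRegularPoint d₁ d₂ x) (k : Fin 3) : node d₁ d₂ k ≠ x := by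
  match k with
  | 0 => exact ((node_zero_lt hd₁ hd₂ hd₂').trans ((neg_lt_zero.2 hd₂).trans hx.pos)).ne
  | 1 => exact hx.ne_node.symm
  | 2 => exact hx.pos.ne

theorem IsRegularPoint.node_mul_ne_zero (hd₁ : 0 < d₁) (hd₂ : 0 < d₂) (hd₂' : d₂ < 1) {x : ℝ}
    (hx : IsRegularPoint d₁ d₂ x) (k : Fin 3) : node d₁ d₂ k * x + modulus d₁ d₂ ≠ 0 :=
  node_mul_add_modulus_ne_zero hd₁ hd₂ hd₂' hx.ne_z₁ ((neg_lt_zero.2 hd₂).trans hx.pos).ne' k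

theorem node_mul_node_ne_zero (hd₁ : 0 < d₁) (hd₂ : 0 < d₂) (hd₂' : d₂ < 1) (k l : Fin 3) :
    node d₁ d₂ k * node d₁ d₂ l + modulus d₁ d₂ ≠ 0 := by
  have hz₁ : 0 < z₁ d₁ d₂ := hd₁
  have hz₂ : 0 < z₂ d₁ d₂ := hd₂
  have hn₀ := node_zero_lt hd₁ hd₂ hd₂'
  have hn₁ := z₁_lt_node_one hd₁ hd₂ hd₂'
  have hn₂ : node d₁ d₂ 2 = 0 := rfl
  have hl : node d₁ d₂ l ≠ z₁ d₁ d₂ ∧ node d₁ d₂ l ≠ -z₂ d₁ d₂ := by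
    match l with
    | 0 => constructor <;> linarith
    | 1 => constructor <;> linarith
    | 2 => constructor <;> linarith
  exact node_mul_add_modulus_ne_zero hd₁ hd₂ hd₂' hl.1 hl.2 k

theorem node_injective (hd₁ : 0 < d₁) (hd₂ : 0 < d₂) (hd₂' : d₂ < 1) :
    Function.Injective (node d₁ d₂) := by
  have hn₀ : node d₁ d₂ 0 < node d₁ d₂ 2 :=
    (node_zero_lt hd₁ hd₂ hd₂').trans (neg_lt_zero.2 hd₂)
  have hn₁ : node d₁ d₂ 2 < node d₁ d₂ 1 := hd₁.trans (z₁_lt_node_one hd₁ hd₂ hd₂')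
  have := hn₀.trans hn₁
  intro k l hkl
  match k, l with
  | 0, 0 | 1, 1 | 2, 2 => rfl
  | 0, 1 | 1, 0 | 0, 2 | 2, 0 | 1, 2 | 2, 1 => linarith

theorem isAdmissible_node (hd₁ : 0 < d₁) (hd₂ : 0 < d₂) (hd₂' : d₂ < 1)
    (ht : ∀ i, IsRegularPoint d₁ d₂ (t i)) (hs : ∀ i, IsRegularPoint d₁ d₂ (s i))
    (hts : ∀ i j, i ≠ j → t i ≠ s j) : IsAdmissible (modulus d₁ d₂) (node d₁ d₂) t s := by
  have hpoints : ∀ x ∈ points (node d₁ d₂) t s,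
      (∃ k, x = node d₁ d₂ k) ∨ IsRegularPoint d₁ d₂ x := by
    rintro _ ⟨k | i | i, rfl⟩
    exacts [Or.inl ⟨k, rfl⟩, Or.inr (ht i), Or.inr (hs i)]
  refine ⟨node_injective hd₁ hd₂ hd₂', fun x hx y hy => ?_, fun i => (ht i).pos.ne',
    fun i => (hs i).pos.ne', fun k i => (ht i).node_ne hd₁ hd₂ hd₂' k,
    fun k i => (hs i).node_ne hd₁ hd₂ hd₂' k, hts⟩
  rcases hpoints x hx with ⟨k, rfl⟩ | hx' <;> rcases hpoints y hy with ⟨l, rfl⟩ | hy'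
  · exact node_mul_node_ne_zero hd₁ hd₂ hd₂' k l
  · exact hy'.node_mul_ne_zero hd₁ hd₂ hd₂' k
  · rw [mul_comm]
    exact hx'.node_mul_ne_zero hd₁ hd₂ hd₂' l
  · exact (add_pos (mul_pos hx'.pos hy'.pos) (modulus_pos hd₁ hd₂ hd₂')).ne'

theorem φ_div_φ (m n : ℤ) (x y : ℝ) : φ d₁ d₂ m n x / φ d₁ d₂ m n y =
    (a₃ d₁ d₂ x / a₃ d₁ d₂ y / (a₁ d₁ d₂ x / a₁ d₁ d₂ y)) ^ m * (a₁ d₁ d₂ x / a₁ d₁ d₂ y) ^ n := by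
  rw [φ, φ, mul_div_mul_comm, ← div_zpow, ← div_zpow, div_div_div_comm]

theorem a₁_ne_zero (hd₁ : 0 < d₁) (hd₂ : 0 < d₂) (hd₂' : d₂ < 1) {x : ℝ}
    (hx : IsRegularPoint d₁ d₂ x) : a₁ d₁ d₂ x ≠ 0 := by
  have : 0 < 1 - d₂ := sub_pos.2 hd₂'
  have hx₀ := hx.pos
  refine div_ne_zero (ne_of_gt ?_) (sub_ne_zero.2 hx.ne_z₁.symm)
  simp only [z₂, z₃, z₄]
  positivity

theorem a₂_ne_zero (hd₂ : 0 < d₂) (hd₂' : d₂ < 1) {x : ℝ} (hx : IsRegularPoint d₁ d₂ x) :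
    a₂ d₁ d₂ x ≠ 0 := by
  have hz₃ : z₃ d₁ d₂ ≠ 0 := (sub_pos.2 hd₂').ne'
  refine div_ne_zero (fun h => hx.ne_node ?_) (add_pos hd₂ hx.pos).ne'
  rw [node, Matrix.cons_val_one, Matrix.cons_val_zero, eq_div_iff hz₃]
  linarith

theorem div_a₃_eq_of_ψ_eq (hd₁ : 0 < d₁) (hd₂ : 0 < d₂) (hd₂' : d₂ < 1) {x y : ℝ}
    (hx : IsRegularPoint d₁ d₂ x) (hy : IsRegularPoint d₁ d₂ y) (h : ψ d₁ d₂ x = ψ d₁ d₂ y) :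
    a₃ d₁ d₂ x / a₃ d₁ d₂ y =
      (a₁ d₁ d₂ x / a₁ d₁ d₂ y) ^ 2 * (a₂ d₁ d₂ x / a₂ d₁ d₂ y) := by
  have hden : ∀ u, IsRegularPoint d₁ d₂ u → a₁ d₁ d₂ u ^ 2 * a₂ d₁ d₂ u ≠ 0 := fun u hu =>
    mul_ne_zero (pow_ne_zero 2 (a₁_ne_zero hd₁ hd₂ hd₂' hu)) (a₂_ne_zero hd₂ hd₂' hu)
  have hy₃ : a₃ d₁ d₂ y ≠ 0 := hy.pos.ne'
  rw [ψ, ψ, div_eq_div_iff (hden x hx) (hden y hy)] at h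
  rw [div_pow, div_mul_div_comm, div_eq_div_iff hy₃ (hden y hy), h, mul_comm]

/-- The change of `m` in the shift of the lattice that belongs to each node. -/
def shiftM : Fin 3 → ℤ := ![0, 1, 1]

/-- The change of `n` in the shift of the lattice that belongs to each node. -/
def shiftN : Fin 3 → ℤ := ![1, -1, 1]

theorem φ_div_φ_shift (hd₁ : 0 < d₁) (hd₂ : 0 < d₂) (hd₂' : d₂ < 1) {x y : ℝ}
    (hx : IsRegularPoint d₁ d₂ x) (hy : IsRegularPoint d₁ d₂ y) (h : ψ d₁ d₂ x = ψ d₁ d₂ y)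
    (m n : ℤ) (k : Fin 3) :
    φ d₁ d₂ (m + shiftM k) (n + shiftN k) x / φ d₁ d₂ (m + shiftM k) (n + shiftN k) y =
      φ d₁ d₂ m n x / φ d₁ d₂ m n y * solitonFactor (modulus d₁ d₂) x y (node d₁ d₂ k) := by
  have h₁ : a₁ d₁ d₂ x / a₁ d₁ d₂ y ≠ 0 :=
    div_ne_zero (a₁_ne_zero hd₁ hd₂ hd₂' hx) (a₁_ne_zero hd₁ hd₂ hd₂' hy)
  have h₃ : a₃ d₁ d₂ x / a₃ d₁ d₂ y / (a₁ d₁ d₂ x / a₁ d₁ d₂ y) ≠ 0 :=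
    div_ne_zero (div_ne_zero hx.pos.ne' hy.pos.ne') h₁
  have h₂ : a₂ d₁ d₂ x / a₂ d₁ d₂ y =
      a₃ d₁ d₂ x / a₃ d₁ d₂ y / (a₁ d₁ d₂ x / a₁ d₁ d₂ y) * (a₁ d₁ d₂ x / a₁ d₁ d₂ y)⁻¹ := by
    rw [div_a₃_eq_of_ψ_eq hd₁ hd₂ hd₂' hx hy h, sq, mul_assoc, mul_div_cancel_left₀ _ h₁,
      mul_comm, inv_mul_cancel_left₀ h₁]
  rw [φ_div_φ, φ_div_φ, zpow_add₀ h₃, zpow_add₀ h₁, mul_mul_mul_comm]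
  congr 1
  match k with
  | 0 =>
    rw [solitonFactor_node_zero hd₁ hd₂ hd₂']
    exact (congrArg₂ _ (zpow_zero _) (zpow_one _)).trans (one_mul _)
  | 1 =>
    rw [solitonFactor_node_one hd₁ hd₂', h₂]
    exact congrArg₂ _ (zpow_one _) (zpow_neg_one _)
  | 2 =>
    rw [solitonFactor_node_two hd₁ hd₂ hd₂']
    exact (congrArg₂ _ (zpow_one _) (zpow_one _)).trans (div_mul_cancel₀ _ h₁)

theorem soliton_shift (hd₁ : 0 < d₁) (hd₂ : 0 < d₂) (hd₂' : d₂ < 1)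
    (ht : ∀ i, IsRegularPoint d₁ d₂ (t i)) (hs : ∀ i, IsRegularPoint d₁ d₂ (s i))
    (hψ : ∀ i, ψ d₁ d₂ (t i) = ψ d₁ d₂ (s i)) (m n : ℤ) (E : Finset (Fin 3)) :
    soliton d₁ d₂ c t s (m + ∑ k ∈ E, shiftM k) (n + ∑ k ∈ E, shiftN k) =
      tau (coupling (modulus d₁ d₂) t s) fun i => c i * (φ d₁ d₂ m n (t i) / φ d₁ d₂ m n (s i)) *
        ∏ k ∈ E, solitonFactor (modulus d₁ d₂) (t i) (s i) (node d₁ d₂ k) := by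
  have hφ : ∀ i, φ d₁ d₂ (m + ∑ k ∈ E, shiftM k) (n + ∑ k ∈ E, shiftN k) (t i) /
      φ d₁ d₂ (m + ∑ k ∈ E, shiftM k) (n + ∑ k ∈ E, shiftN k) (s i) =
      φ d₁ d₂ m n (t i) / φ d₁ d₂ m n (s i) *
        ∏ k ∈ E, solitonFactor (modulus d₁ d₂) (t i) (s i) (node d₁ d₂ k) := by
    intro i
    induction E using Finset.induction_on with
    | empty => simp only [sum_empty, add_zero, prod_empty, mul_one]
    | insert k E hk ih =>
      rw [sum_insert hk, sum_insert hk, prod_insert hk, add_comm (shiftM k), add_comm (shiftN k),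
        ← add_assoc, ← add_assoc, φ_div_φ_shift hd₁ hd₂ hd₂' (ht i) (hs i) (hψ i), ih,
        mul_assoc, mul_comm (∏ _ ∈ E, _)]
  simp only [soliton, b_eq_coupling hd₂', hφ, ← mul_assoc]
  rfl

theorem sum_soliton_shift (hd₁ : 0 < d₁) (hd₂ : 0 < d₂) (hd₂' : d₂ < 1)
    (ht : ∀ i, IsRegularPoint d₁ d₂ (t i)) (hs : ∀ i, IsRegularPoint d₁ d₂ (s i))
    (hts : ∀ i j, i ≠ j → t i ≠ s j) (hψ : ∀ i, ψ d₁ d₂ (t i) = ψ d₁ d₂ (s i)) (m n : ℤ) :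
    ∑ k, ![z₁ d₁ d₂, z₂ d₁ d₂, z₃ d₁ d₂] k *
        (soliton d₁ d₂ c t s (m + shiftM k) (n + shiftN k) *
          soliton d₁ d₂ c t s (m + ∑ l ∈ univ.erase k, shiftM l)
            (n + ∑ l ∈ univ.erase k, shiftN l)) =
      z₄ d₁ d₂ * (soliton d₁ d₂ c t s m n *
        soliton d₁ d₂ c t s (m + ∑ k, shiftM k) (n + ∑ k, shiftN k)) := by
  have hκ := (modulus_pos hd₁ hd₂ hd₂').ne'
  have hz₄ : z₄ d₁ d₂ ≠ 0 := (add_pos one_pos hd₁).ne'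
  have hshift := soliton_shift (c := c) hd₁ hd₂ hd₂' ht hs hψ m n
  have h₀ := hshift ∅
  have h₁ := fun k => hshift {k}
  simp only [sum_empty, add_zero, prod_empty, mul_one] at h₀
  simp only [sum_singleton, prod_singleton] at h₁
  have hmiwa := (isAdmissible_node hd₁ hd₂ hd₂' ht hs hts).miwa hκ (m := 1) rfl
    fun i => c i * (φ d₁ d₂ m n (t i) / φ d₁ d₂ m n (s i))
  simp only [← h₁, ← hshift, ← h₀, prod_inv_pairFactor_node hd₁ hd₂ hd₂', pow_one] at hmiwa
  simp only [mul_assoc, ← mul_sum] at hmiwa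
  rw [← mul_left_cancel₀ (neg_ne_zero.2 hκ) hmiwa, mul_sum]
  exact sum_congr rfl fun k _ => by rw [← mul_assoc (z₄ d₁ d₂), mul_div_cancel₀ _ hz₄]

theorem isSolution_soliton (hd₁ : 0 < d₁) (hd₂ : 0 < d₂) (hd₂' : d₂ < 1)
    (ht : ∀ i, IsRegularPoint d₁ d₂ (t i)) (hs : ∀ i, IsRegularPoint d₁ d₂ (s i))
    (hts : ∀ i j, i ≠ j → t i ≠ s j) (hψ : ∀ i, ψ d₁ d₂ (t i) = ψ d₁ d₂ (s i)) :
    IsSolution d₁ d₂ (soliton d₁ d₂ c t s) := by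
  intro m n
  have h := sum_soliton_shift (c := c) hd₁ hd₂ hd₂' ht hs hts hψ (m - 1) n
  rw [Fin.sum_univ_three] at h
  change z₁ d₁ d₂ * (soliton d₁ d₂ c t s (m - 1 + 0) (n + 1) *
      soliton d₁ d₂ c t s (m - 1 + 2) (n + 0)) +
    z₂ d₁ d₂ * (soliton d₁ d₂ c t s (m - 1 + 1) (n + -1) *
      soliton d₁ d₂ c t s (m - 1 + 1) (n + 2)) +
    z₃ d₁ d₂ * (soliton d₁ d₂ c t s (m - 1 + 1) (n + 1) *
      soliton d₁ d₂ c t s (m - 1 + 1) (n + 0)) =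
    z₄ d₁ d₂ * (soliton d₁ d₂ c t s (m - 1) n * soliton d₁ d₂ c t s (m - 1 + 2) (n + 1)) at h
  rw [sub_add_cancel, add_zero, add_zero, ← sub_eq_add_neg, show m - 1 + 2 = m + 1 by ring] at h
  simp only [z₁, z₂, z₃, z₄] at h
  linear_combination -h

end Solution

end

open Set Filter Topology

theorem tendsto_sub_div_sub_atTop (a b : ℝ) :
    Tendsto (fun t : ℝ => (t - a) / (t - b)) atTop (𝓝 1) := by
  have h : Tendsto (fun t : ℝ => 1 + (b - a) / (t - b)) atTop (𝓝 (1 + 0)) :=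
    (tendsto_const_nhds.div_atTop (tendsto_atTop_add_const_right _ _ tendsto_id)).const_add 1
  rw [add_zero] at h
  refine h.congr' ?_
  filter_upwards [eventually_gt_atTop b] with t ht
  rw [one_add_div (sub_pos.2 ht).ne', sub_add_sub_cancel]

/-- `f` is unimodal on `J` with mode `α`: strictly increasing up to `α`, strictly decreasing after
it. -/
structure IsUnimodalOn {X Y : Type*} [Preorder X] [Preorder Y] (f : X → Y) (J : Set X) (α : X) :
    Prop where
  mem : α ∈ J
  strictMonoOn : StrictMonoOn f (J ∩ Iic α)
  strictAntiOn : StrictAntiOn f (J ∩ Ici α)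

section LinearOrder

variable {X Y : Type*} [LinearOrder X] [LinearOrder Y] {f : X → Y} {J : Set X} {α : X}

theorem IsUnimodalOn.min_lt (h : IsUnimodalOn f J α) {x y z : X} (hx : x ∈ J) (hy : y ∈ J)
    (hz : z ∈ J) (hxy : x < y) (hyz : y < z) : min (f x) (f z) < f y := by
  rcases le_total y α with hyα | hyα
  · exact (min_le_left _ _).trans_lt (h.strictMonoOn ⟨hx, hxy.le.trans hyα⟩ ⟨hy, hyα⟩ hxy)
  · exact (min_le_right _ _).trans_lt (h.strictAntiOn ⟨hy, hyα⟩ ⟨hz, hyα.trans hyz.le⟩ hyz)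

end LinearOrder

theorem IsUnimodalOn.nested {R Y : Type*} [CommRing R] [LinearOrder R] [IsStrictOrderedRing R]
    [LinearOrder Y] {f : R → Y} {J : Set R} {α : R} (h : IsUnimodalOn f J α) {t s t' s' : R}
    (ht : t ∈ J) (hs : s ∈ J) (ht' : t' ∈ J) (hs' : s' ∈ J) (hts : f t = f s) (hts' : f t' = f s') :
    0 ≤ ((t - t') * (t - s')) * ((s - t') * (s - s')) := by
  wlog hlt : t' ≤ s' generalizing t' s'
  · have := this hs' ht' hts'.symm (le_of_not_ge hlt)
    rwa [mul_comm (t - s'), mul_comm (s - s')] at this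
  rcases hlt.eq_or_lt with rfl | hlt
  · exact mul_nonneg (mul_self_nonneg _) (mul_self_nonneg _)
  have inside : ∀ x ∈ J, t' < x → x < s' → f t' < f x := fun x hx h1 h2 => by
    simpa [hts'] using h.min_lt ht' hx hs' h1 h2
  have left : ∀ x ∈ J, x < t' → f x < f t' := fun x hx h1 => by
    have := h.min_lt hx ht' hs' h1 hlt
    rwa [← hts', min_lt_iff, or_iff_left (lt_irrefl _)] at this
  have right : ∀ x ∈ J, s' < x → f x < f t' := fun x hx h1 => by
    have := h.min_lt ht' hs' hx hlt h1
    rwa [← hts', min_lt_iff, or_iff_right (lt_irrefl _)] at this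
  have neg : ∀ x ∈ J, f t' ≤ f x → (x - t') * (x - s') ≤ 0 := fun x hx hle =>
    mul_nonpos_of_nonneg_of_nonpos (sub_nonneg.2 (le_of_not_gt fun h1 => (left x hx h1).not_ge hle))
      (sub_nonpos.2 (le_of_not_gt fun h1 => (right x hx h1).not_ge hle))
  have pos : ∀ x ∈ J, f x ≤ f t' → 0 ≤ (x - t') * (x - s') := by
    intro x hx hle
    rcases le_or_gt x t' with h1 | h1
    · exact mul_nonneg_of_nonpos_of_nonpos (by linarith) (by linarith)
    · have h2 : s' ≤ x := le_of_not_gt fun h2 => (inside x hx h1 h2).not_ge hle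
      exact mul_nonneg (by linarith) (by linarith)
  rcases le_total (f t') (f t) with hle | hle
  · exact mul_nonneg_of_nonpos_of_nonpos (neg t ht hle) (neg s hs (hts ▸ hle))
  · exact mul_nonneg (pos t ht hle) (pos s hs (hts ▸ hle))

section ContinuousOn

variable {X Y : Type*} [ConditionallyCompleteLinearOrder X] [TopologicalSpace X] [OrderTopology X]
  [LinearOrder Y] [TopologicalSpace Y] [OrderClosedTopology Y] {f : X → Y} {J : Set X} {α : X}

theorem exists_isLocalMax_of_lt (hJ : J.OrdConnected) (hf : ContinuousOn f J) {x y z : X}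
    (hx : x ∈ J) (hz : z ∈ J) (hxy : x < y) (hyz : y < z) (hfx : f x < f y) (hfz : f z < f y) :
    ∃ α ∈ J, IsLocalMax f α := by
  have hsub : Icc x z ⊆ J := hJ.out hx hz
  have hends : ∀ w ∈ Icc x z \ Ioo x z, f w < f y := by
    intro w hw
    rw [Icc_sdiff_Ioo_same (hxy.trans hyz).le] at hw
    rcases hw with rfl | rfl
    exacts [hfx, hfz]
  obtain ⟨α, hα, hmax⟩ := isCompact_Icc.exists_isLocalMax_mem_open Ioo_subset_Icc_self
    (hf.mono hsub) ⟨hxy.le, hyz.le⟩ hends isOpen_Ioo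
  exact ⟨α, hsub (Ioo_subset_Icc_self hα), hmax⟩

theorem IsUnimodalOn.existsUnique_partner [DenselyOrdered X] (h : IsUnimodalOn f J α)
    (hJ : J.OrdConnected) (hf : ContinuousOn f J) (hleft : ∀ t ∈ J, ∃ x ∈ J, x < α ∧ f x < f t)
    (hright : ∀ t ∈ J, ∃ y ∈ J, α < y ∧ f y < f t) {t : X} (ht : t ∈ J) (hne : t ≠ α) :
    ∃! s, s ∈ J ∧ s ≠ t ∧ f t = f s := by
  rcases hne.lt_or_gt with hlt | hlt
  · obtain ⟨y, hy, hαy, hfy⟩ := hright t ht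
    have hsub : Icc α y ⊆ J := hJ.out h.mem hy
    have hfα : f t < f α := h.strictMonoOn ⟨ht, hlt.le⟩ ⟨h.mem, self_mem_Iic⟩ hlt
    obtain ⟨s, hs, hfs⟩ := intermediate_value_Icc' hαy.le (hf.mono hsub) ⟨hfy.le, hfα.le⟩
    refine ⟨s, ⟨hsub hs, (hlt.trans_le hs.1).ne', hfs.symm⟩, ?_⟩
    rintro s' ⟨hs', hs't, hfs'⟩
    rcases le_total s' α with hle | hle
    · exact absurd (h.strictMonoOn.injOn ⟨hs', hle⟩ ⟨ht, hlt.le⟩ hfs'.symm) hs't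
    · exact h.strictAntiOn.injOn ⟨hs', hle⟩ ⟨hsub hs, hs.1⟩ (hfs'.symm.trans hfs.symm)
  · obtain ⟨x, hx, hxα, hfx⟩ := hleft t ht
    have hsub : Icc x α ⊆ J := hJ.out hx h.mem
    have hfα : f t < f α := h.strictAntiOn ⟨h.mem, self_mem_Ici⟩ ⟨ht, hlt.le⟩ hlt
    obtain ⟨s, hs, hfs⟩ := intermediate_value_Icc hxα.le (hf.mono hsub) ⟨hfx.le, hfα.le⟩
    refine ⟨s, ⟨hsub hs, (hs.2.trans_lt hlt).ne, hfs.symm⟩, ?_⟩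
    rintro s' ⟨hs', hs't, hfs'⟩
    rcases le_total s' α with hle | hle
    · exact h.strictMonoOn.injOn ⟨hs', hle⟩ ⟨hsub hs, hs.2⟩ (hfs'.symm.trans hfs.symm)
    · exact absurd (h.strictAntiOn.injOn ⟨hs', hle⟩ ⟨ht, hlt.le⟩ hfs'.symm) hs't

end ContinuousOn

section Deriv

variable {f : ℝ → ℝ} {J : Set ℝ} {α : ℝ}

theorem isUnimodalOn_of_deriv (hJ : IsOpen J) (hJc : Convex ℝ J) (hα : α ∈ J)
    (hf : ContinuousOn f J) (hpos : ∀ t ∈ J, t < α → 0 < deriv f t)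
    (hneg : ∀ t ∈ J, α < t → deriv f t < 0) : IsUnimodalOn f J α := by
  refine ⟨hα, strictMonoOn_of_deriv_pos (hJc.inter (convex_Iic α))
    (hf.mono inter_subset_left) fun x hx => ?_, strictAntiOn_of_deriv_neg
    (hJc.inter (convex_Ici α)) (hf.mono inter_subset_left) fun x hx => ?_⟩
  · rw [interior_inter, interior_Iic, hJ.interior_eq] at hx
    exact hpos x hx.1 hx.2
  · rw [interior_inter, interior_Ici, hJ.interior_eq] at hx
    exact hneg x hx.1 hx.2

theorem isUnimodalOn_of_deriv_eq_neg_mul (hJ : IsOpen J) (hJc : Convex ℝ J) (hα : α ∈ J)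
    (hα₀ : deriv f α = 0) (hf : ContinuousOn f J) {k g : ℝ → ℝ} (hk : ∀ t ∈ J, 0 < k t)
    (hg : StrictMonoOn g J) (hderiv : ∀ t ∈ J, deriv f t = -(k t * g t)) :
    IsUnimodalOn f J α ∧ ∀ t ∈ J, deriv f t = 0 ↔ t = α := by
  have hgα : g α = 0 := by
    rw [hderiv α hα, neg_eq_zero] at hα₀
    exact (mul_eq_zero.1 hα₀).resolve_left (hk α hα).ne'
  have hpos : ∀ t ∈ J, t < α → 0 < deriv f t := fun t ht hlt => by
    rw [hderiv t ht, neg_pos]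
    exact mul_neg_of_pos_of_neg (hk t ht) (hgα ▸ hg ht hα hlt)
  have hneg : ∀ t ∈ J, α < t → deriv f t < 0 := fun t ht hlt => by
    rw [hderiv t ht, neg_lt_zero]
    exact mul_pos (hk t ht) (hgα ▸ hg hα ht hlt)
  refine ⟨isUnimodalOn_of_deriv hJ hJc hα hf hpos hneg, fun t ht => ⟨fun h₀ => ?_, fun h => ?_⟩⟩
  · by_contra hne
    rcases lt_or_gt_of_ne hne with hlt | hlt
    exacts [(hpos t ht hlt).ne' h₀, (hneg t ht hlt).ne h₀]
  · rwa [h]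

end Deriv

section Dispersion

variable {d₁ d₂ t s : ℝ}

theorem z₁_lt_of_mem_J₁ (hd₁ : 0 < d₁) (hd₂ : 0 < d₂) (hd₂' : d₂ < 1) (ht : t ∈ J₁ d₁ d₂) :
    z₁ d₁ d₂ < t :=
  (z₁_lt_node_one hd₁ hd₂ hd₂').trans ht

theorem lt_node_one_of_mem_J₂ (hd₁ : 0 < d₁) (hd₂ : 0 < d₂) (hd₂' : d₂ < 1) (ht : t ∈ J₂ d₁ d₂) :
    t < node d₁ d₂ 1 :=
  LT.lt.trans ht.2 (z₁_lt_node_one hd₁ hd₂ hd₂')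

theorem isRegularPoint_of_mem_J₁ (hd₁ : 0 < d₁) (hd₂ : 0 < d₂) (hd₂' : d₂ < 1)
    (ht : t ∈ J₁ d₁ d₂) : IsRegularPoint d₁ d₂ t :=
  have hlt := z₁_lt_of_mem_J₁ hd₁ hd₂ hd₂' ht
  ⟨hd₁.trans hlt, hlt.ne', ne_of_gt ht⟩

theorem isRegularPoint_of_mem_J₂ (hd₁ : 0 < d₁) (hd₂ : 0 < d₂) (hd₂' : d₂ < 1)
    (ht : t ∈ J₂ d₁ d₂) : IsRegularPoint d₁ d₂ t :=
  ⟨ht.1, ht.2.ne, (lt_node_one_of_mem_J₂ hd₁ hd₂ hd₂' ht).ne⟩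

theorem isRegularPoint_of_mem (hd₁ : 0 < d₁) (hd₂ : 0 < d₂) (hd₂' : d₂ < 1) {J : Set ℝ}
    (hJ : J = J₁ d₁ d₂ ∨ J = J₂ d₁ d₂) (ht : t ∈ J) : IsRegularPoint d₁ d₂ t := by
  rcases hJ with rfl | rfl
  exacts [isRegularPoint_of_mem_J₁ hd₁ hd₂ hd₂' ht, isRegularPoint_of_mem_J₂ hd₁ hd₂ hd₂' ht]

theorem a₁_eq (hd₂' : d₂ < 1) (t : ℝ) :
    a₁ d₁ d₂ t = z₃ d₁ d₂ * ((t - node d₁ d₂ 0) / (z₁ d₁ d₂ - t)) := by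
  have hz₃ : z₃ d₁ d₂ ≠ 0 := (sub_pos.2 hd₂').ne'
  rw [a₁, ← mul_div_assoc]
  congr 1
  simp only [node, Matrix.cons_val]
  rw [sub_neg_eq_add, mul_add, mul_div_cancel₀ _ hz₃, add_comm]

theorem a₂_eq (hd₂' : d₂ < 1) (t : ℝ) :
    a₂ d₁ d₂ t = z₃ d₁ d₂ * ((node d₁ d₂ 1 - t) / (z₂ d₁ d₂ + t)) := by
  have hz₃ : z₃ d₁ d₂ ≠ 0 := (sub_pos.2 hd₂').ne'
  rw [a₂, ← mul_div_assoc]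
  congr 1
  simp only [node, Matrix.cons_val]
  rw [mul_sub, mul_div_cancel₀ _ hz₃]

theorem sub_node_zero_pos (hd₁ : 0 < d₁) (hd₂ : 0 < d₂) (hd₂' : d₂ < 1) (ht : 0 ≤ t) :
    0 < t - node d₁ d₂ 0 :=
  sub_pos.2 (((node_zero_lt hd₁ hd₂ hd₂').trans (neg_lt_zero.2 hd₂)).trans_le ht)

theorem a₁_neg_of_mem_J₁ (hd₁ : 0 < d₁) (hd₂ : 0 < d₂) (hd₂' : d₂ < 1) (ht : t ∈ J₁ d₁ d₂) :
    a₁ d₁ d₂ t < 0 := by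
  have hlt := z₁_lt_of_mem_J₁ hd₁ hd₂ hd₂' ht
  rw [a₁_eq hd₂']
  exact mul_neg_of_pos_of_neg (sub_pos.2 hd₂') (div_neg_of_pos_of_neg
    (sub_node_zero_pos hd₁ hd₂ hd₂' (hd₁.trans hlt).le) (sub_neg.2 hlt))

theorem a₁_pos_of_mem_J₂ (hd₁ : 0 < d₁) (hd₂ : 0 < d₂) (hd₂' : d₂ < 1) (ht : t ∈ J₂ d₁ d₂) :
    0 < a₁ d₁ d₂ t := by
  rw [a₁_eq hd₂']
  exact mul_pos (sub_pos.2 hd₂') (div_pos (sub_node_zero_pos hd₁ hd₂ hd₂' ht.1.le)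
    (sub_pos.2 ht.2))

theorem a₂_neg_of_mem_J₁ (hd₁ : 0 < d₁) (hd₂ : 0 < d₂) (hd₂' : d₂ < 1) (ht : t ∈ J₁ d₁ d₂) :
    a₂ d₁ d₂ t < 0 := by
  rw [a₂_eq hd₂']
  exact mul_neg_of_pos_of_neg (sub_pos.2 hd₂') (div_neg_of_neg_of_pos (sub_neg.2 ht)
    (add_pos hd₂ (isRegularPoint_of_mem_J₁ hd₁ hd₂ hd₂' ht).pos))

theorem a₂_pos_of_mem_J₂ (hd₁ : 0 < d₁) (hd₂ : 0 < d₂) (hd₂' : d₂ < 1) (ht : t ∈ J₂ d₁ d₂) :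
    0 < a₂ d₁ d₂ t := by
  rw [a₂_eq hd₂']
  exact mul_pos (sub_pos.2 hd₂') (div_pos (sub_pos.2 (lt_node_one_of_mem_J₂ hd₁ hd₂ hd₂' ht))
    (add_pos hd₂ ht.1))

theorem ψ_neg_of_mem_J₁ (hd₁ : 0 < d₁) (hd₂ : 0 < d₂) (hd₂' : d₂ < 1) (ht : t ∈ J₁ d₁ d₂) :
    ψ d₁ d₂ t < 0 :=
  div_neg_of_pos_of_neg (isRegularPoint_of_mem_J₁ hd₁ hd₂ hd₂' ht).pos (mul_neg_of_pos_of_neg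
    (sq_pos_of_neg (a₁_neg_of_mem_J₁ hd₁ hd₂ hd₂' ht)) (a₂_neg_of_mem_J₁ hd₁ hd₂ hd₂' ht))

theorem ψ_pos_of_mem_J₂ (hd₁ : 0 < d₁) (hd₂ : 0 < d₂) (hd₂' : d₂ < 1) (ht : t ∈ J₂ d₁ d₂) :
    0 < ψ d₁ d₂ t :=
  div_pos ht.1 (mul_pos (pow_pos (a₁_pos_of_mem_J₂ hd₁ hd₂ hd₂' ht) 2)
    (a₂_pos_of_mem_J₂ hd₁ hd₂ hd₂' ht))

theorem ψ_eq (hd₂' : d₂ < 1) (t : ℝ) : ψ d₁ d₂ t =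
    t * (z₁ d₁ d₂ - t) ^ 2 * (z₂ d₁ d₂ + t) /
      (z₃ d₁ d₂ ^ 3 * (t - node d₁ d₂ 0) ^ 2 * (node d₁ d₂ 1 - t)) := by
  rw [ψ, a₁_eq hd₂', a₂_eq hd₂', a₃, ← mul_div_assoc, ← mul_div_assoc, div_pow, div_mul_div_comm,
    div_div_eq_mul_div, mul_assoc]
  congr 1
  ring

theorem continuousAt_ψ (hd₁ : 0 < d₁) (hd₂ : 0 < d₂) (hd₂' : d₂ < 1) (ht : 0 ≤ t)
    (ht₁ : t ≠ node d₁ d₂ 1) : ContinuousAt (ψ d₁ d₂) t := by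
  have hden : z₃ d₁ d₂ ^ 3 * (t - node d₁ d₂ 0) ^ 2 * (node d₁ d₂ 1 - t) ≠ 0 :=
    mul_ne_zero (mul_ne_zero (pow_ne_zero 3 (sub_pos.2 hd₂').ne')
      (pow_ne_zero 2 (sub_node_zero_pos hd₁ hd₂ hd₂' ht).ne')) (sub_ne_zero.2 ht₁.symm)
  rw [show ψ d₁ d₂ = _ from funext (ψ_eq hd₂')]
  exact ContinuousAt.div (by fun_prop) (by fun_prop) hden

theorem continuousOn_ψ (hd₁ : 0 < d₁) (hd₂ : 0 < d₂) (hd₂' : d₂ < 1) {J : Set ℝ}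
    (hJ : J = J₁ d₁ d₂ ∨ J = J₂ d₁ d₂) : ContinuousOn (ψ d₁ d₂) J := fun _ ht =>
  have hreg := isRegularPoint_of_mem hd₁ hd₂ hd₂' hJ ht
  (continuousAt_ψ hd₁ hd₂ hd₂' hreg.pos.le hreg.ne_node).continuousWithinAt

/-- The logarithmic derivative of `ψ`, cleared of its double poles at the zero and the pole of `a₁`
and expanded in partial fractions. -/
noncomputable def criticalFunction (d₁ d₂ t : ℝ) : ℝ :=
  t + -node d₁ d₂ 0 * z₁ d₁ d₂ * -t⁻¹ +
      (-z₂ d₁ d₂ - node d₁ d₂ 0) * (z₁ d₁ d₂ + z₂ d₁ d₂) * -(t - -z₂ d₁ d₂)⁻¹ +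
    (node d₁ d₂ 1 - z₁ d₁ d₂) * (node d₁ d₂ 1 - node d₁ d₂ 0) * -(t - node d₁ d₂ 1)⁻¹ +
      (z₁ d₁ d₂ - z₂ d₁ d₂ - 3 * node d₁ d₂ 0 - node d₁ d₂ 1)

theorem strictMonoOn_criticalFunction (hd₁ : 0 < d₁) (hd₂ : 0 < d₂) (hd₂' : d₂ < 1) {J : Set ℝ}
    (hJ : J = J₁ d₁ d₂ ∨ J = J₂ d₁ d₂) : StrictMonoOn (criticalFunction d₁ d₂) J := by
  have hz₁ : 0 < z₁ d₁ d₂ := hd₁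
  have hz₂ : 0 < z₂ d₁ d₂ := hd₂
  have hn₀ := node_zero_lt hd₁ hd₂ hd₂'
  have hn₁ := z₁_lt_node_one hd₁ hd₂ hd₂'
  have hpos : J ⊆ Ioi 0 := fun t ht => (isRegularPoint_of_mem hd₁ hd₂ hd₂' hJ ht).pos
  have h₁ : AntitoneOn (fun t => (t - node d₁ d₂ 1)⁻¹) J := by
    rcases hJ with rfl | rfl
    · exact sub_inv_antitoneOn_Ioi
    · exact sub_inv_antitoneOn_Iio.mono fun t ht => lt_node_one_of_mem_J₂ hd₁ hd₂ hd₂' ht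
  have h₂ : AntitoneOn (fun t => (t - -z₂ d₁ d₂)⁻¹) J :=
    sub_inv_antitoneOn_Ioi.mono fun t ht => (neg_lt_zero.2 hd₂).trans (hpos ht)
  have h₃ : AntitoneOn (fun t : ℝ => t⁻¹) J := inv_antitoneOn_Ioi.mono hpos
  intro x hx y hy hxy
  refine add_lt_add_left (add_lt_add_of_lt_of_le (add_lt_add_of_lt_of_le
    (add_lt_add_of_lt_of_le hxy ?_) ?_) ?_) _
  · exact mul_le_mul_of_nonneg_left (neg_le_neg (h₃ hx hy hxy.le))
      (mul_nonneg (by linarith) hz₁.le)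
  · exact mul_le_mul_of_nonneg_left (neg_le_neg (h₂ hx hy hxy.le))
      (mul_nonneg (by linarith) (by linarith))
  · exact mul_le_mul_of_nonneg_left (neg_le_neg (h₁ hx hy hxy.le))
      (mul_nonneg (by linarith) (by linarith))

theorem logDeriv_a₁ (hd₂' : d₂ < 1) (h₀ : t ≠ node d₁ d₂ 0) (h₁ : t ≠ z₁ d₁ d₂) :
    logDeriv (a₁ d₁ d₂) t = 1 / (t - node d₁ d₂ 0) - 1 / (t - z₁ d₁ d₂) := by
  have hz₃ : z₃ d₁ d₂ ≠ 0 := (sub_pos.2 hd₂').ne'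
  rw [show a₁ d₁ d₂ = _ from funext (a₁_eq hd₂'), logDeriv_const_mul _ _ hz₃,
    logDeriv_div (f := fun x => x - node d₁ d₂ 0) (g := fun x => z₁ d₁ d₂ - x) t
      (sub_ne_zero.2 h₀) (sub_ne_zero.2 h₁.symm) (by fun_prop) (by fun_prop),
    logDeriv_apply, logDeriv_apply, deriv_sub_const, deriv_const_sub, deriv_id'', ← neg_sub t,
    neg_div_neg_eq]

theorem logDeriv_a₂ (hd₂' : d₂ < 1) (h₁ : t ≠ node d₁ d₂ 1) (h₂ : z₂ d₁ d₂ + t ≠ 0) :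
    logDeriv (a₂ d₁ d₂) t = 1 / (t - node d₁ d₂ 1) - 1 / (z₂ d₁ d₂ + t) := by
  have hz₃ : z₃ d₁ d₂ ≠ 0 := (sub_pos.2 hd₂').ne'
  rw [show a₂ d₁ d₂ = _ from funext (a₂_eq hd₂'), logDeriv_const_mul _ _ hz₃,
    logDeriv_div (f := fun x => node d₁ d₂ 1 - x) (g := fun x => z₂ d₁ d₂ + x) t
      (sub_ne_zero.2 h₁.symm) h₂ (by fun_prop) (by fun_prop),
    logDeriv_apply, logDeriv_apply, deriv_const_add, deriv_const_sub, deriv_id'', ← neg_sub t,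
    neg_div_neg_eq]

theorem differentiableAt_a₁ (h : t ≠ z₁ d₁ d₂) : DifferentiableAt ℝ (a₁ d₁ d₂) t :=
  DifferentiableAt.div (by fun_prop) (by fun_prop) (sub_ne_zero.2 h.symm)

theorem differentiableAt_a₂ (h : z₂ d₁ d₂ + t ≠ 0) : DifferentiableAt ℝ (a₂ d₁ d₂) t :=
  DifferentiableAt.div (by fun_prop) (by fun_prop) h

theorem logDeriv_ψ (hd₁ : 0 < d₁) (hd₂ : 0 < d₂) (hd₂' : d₂ < 1) (ht : IsRegularPoint d₁ d₂ t) :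
    logDeriv (ψ d₁ d₂) t = criticalFunction d₁ d₂ t /
      ((t - node d₁ d₂ 0) * (t - z₁ d₁ d₂)) := by
  have ht₀ : t ≠ 0 := ht.pos.ne'
  have h₁ := a₁_ne_zero hd₁ hd₂ hd₂' ht
  have h₂ := a₂_ne_zero hd₂ hd₂' ht
  have hp₀ : t - node d₁ d₂ 0 ≠ 0 := (sub_node_zero_pos hd₁ hd₂ hd₂' ht.pos.le).ne'
  have hp₁ : t - node d₁ d₂ 1 ≠ 0 := sub_ne_zero.2 ht.ne_node
  have hp₂ : z₂ d₁ d₂ + t ≠ 0 := (add_pos hd₂ ht.pos).ne'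
  have hp₃ : t - z₁ d₁ d₂ ≠ 0 := sub_ne_zero.2 ht.ne_z₁
  have hd₁a := differentiableAt_a₁ ht.ne_z₁
  have hd₂a := differentiableAt_a₂ hp₂
  have hlog : logDeriv (ψ d₁ d₂) t =
      1 / t - (2 * logDeriv (a₁ d₁ d₂) t + logDeriv (a₂ d₁ d₂) t) := by
    rw [show ψ d₁ d₂ = fun x => x / (a₁ d₁ d₂ x ^ 2 * a₂ d₁ d₂ x) from rfl,
      logDeriv_div (f := fun x => x) (g := fun x => a₁ d₁ d₂ x ^ 2 * a₂ d₁ d₂ x) t ht₀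
        (mul_ne_zero (pow_ne_zero 2 h₁) h₂) differentiableAt_id ((hd₁a.fun_pow 2).fun_mul hd₂a),
      logDeriv_mul (f := fun x => a₁ d₁ d₂ x ^ 2) t (pow_ne_zero 2 h₁) h₂ (hd₁a.fun_pow 2) hd₂a,
      logDeriv_fun_pow hd₁a, logDeriv_id', Nat.cast_ofNat]
  rw [hlog, logDeriv_a₁ hd₂' (sub_ne_zero.1 hp₀) ht.ne_z₁, logDeriv_a₂ hd₂' ht.ne_node hp₂]
  rw [criticalFunction, sub_neg_eq_add, add_comm t (z₂ d₁ d₂)]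
  generalize node d₁ d₂ 0 = n₀, node d₁ d₂ 1 = n₁, z₁ d₁ d₂ = z₁, z₂ d₁ d₂ = z₂ at *
  field_simp
  ring

theorem deriv_ψ (hd₁ : 0 < d₁) (hd₂ : 0 < d₂) (hd₂' : d₂ < 1) (ht : IsRegularPoint d₁ d₂ t) :
    deriv (ψ d₁ d₂) t = -(ψ d₁ d₂ t / ((t - node d₁ d₂ 0) * (z₁ d₁ d₂ - t)) *
      criticalFunction d₁ d₂ t) := by
  have hψ : ψ d₁ d₂ t ≠ 0 := div_ne_zero ht.pos.ne'
    (mul_ne_zero (pow_ne_zero 2 (a₁_ne_zero hd₁ hd₂ hd₂' ht)) (a₂_ne_zero hd₂ hd₂' ht))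
  have h := logDeriv_ψ hd₁ hd₂ hd₂' ht
  rw [logDeriv_apply, div_eq_iff hψ] at h
  rw [h, ← neg_sub t, mul_neg, div_neg, neg_mul, neg_neg, div_mul_comm, mul_comm]

theorem ψ_div_pos (hd₁ : 0 < d₁) (hd₂ : 0 < d₂) (hd₂' : d₂ < 1) {J : Set ℝ}
    (hJ : J = J₁ d₁ d₂ ∨ J = J₂ d₁ d₂) (ht : t ∈ J) :
    0 < ψ d₁ d₂ t / ((t - node d₁ d₂ 0) * (z₁ d₁ d₂ - t)) := by
  have h₀ := sub_node_zero_pos hd₁ hd₂ hd₂' (isRegularPoint_of_mem hd₁ hd₂ hd₂' hJ ht).pos.le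
  rcases hJ with rfl | rfl
  · exact div_pos_of_neg_of_neg (ψ_neg_of_mem_J₁ hd₁ hd₂ hd₂' ht)
      (mul_neg_of_pos_of_neg h₀ (sub_neg.2 (z₁_lt_of_mem_J₁ hd₁ hd₂ hd₂' ht)))
  · exact div_pos (ψ_pos_of_mem_J₂ hd₁ hd₂ hd₂' ht) (mul_pos h₀ (sub_pos.2 ht.2))

theorem tendsto_ψ_nhdsGT_node_one (hd₁ : 0 < d₁) (hd₂ : 0 < d₂) (hd₂' : d₂ < 1) :
    Tendsto (ψ d₁ d₂) (𝓝[>] node d₁ d₂ 1) atBot := by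
  have hlt := z₁_lt_node_one hd₁ hd₂ hd₂'
  have hpos : 0 < node d₁ d₂ 1 := hd₁.trans hlt
  have hz : z₁ d₁ d₂ - node d₁ d₂ 1 ≠ 0 := (sub_neg.2 hlt).ne
  have hz₃ : z₃ d₁ d₂ ≠ 0 := (sub_pos.2 hd₂').ne'
  have ha₁ : a₁ d₁ d₂ (node d₁ d₂ 1) ≠ 0 := by
    rw [a₁_eq hd₂']
    exact mul_ne_zero hz₃ (div_ne_zero (sub_node_zero_pos hd₁ hd₂ hd₂' hpos.le).ne' hz)
  have ha₂ : Tendsto (a₂ d₁ d₂) (𝓝[>] node d₁ d₂ 1) (𝓝[<] 0) := by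
    refine tendsto_nhdsWithin_iff.2 ⟨?_, ?_⟩
    · have h := (differentiableAt_a₂ (d₁ := d₁) (add_pos hd₂ hpos).ne').continuousAt.tendsto
      rw [a₂_eq hd₂', sub_self, zero_div, mul_zero] at h
      exact h.mono_left nhdsWithin_le_nhds
    · filter_upwards [self_mem_nhdsWithin] with t ht
      exact a₂_neg_of_mem_J₁ hd₁ hd₂ hd₂' ht
  have hfront : ContinuousAt (fun t => t / a₁ d₁ d₂ t ^ 2) (node d₁ d₂ 1) :=
    continuousAt_id.div ((differentiableAt_a₁ hlt.ne').continuousAt.pow 2) (pow_ne_zero 2 ha₁)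
  refine (Tendsto.pos_mul_atBot (div_pos hpos (sq_pos_of_ne_zero ha₁))
    (hfront.mono_left nhdsWithin_le_nhds) (tendsto_inv_nhdsLT_zero.comp ha₂)).congr fun t => ?_
  rw [ψ, a₃, Function.comp_apply, ← div_eq_mul_inv, div_div]

theorem tendsto_ψ_atTop (hd₂' : d₂ < 1) : Tendsto (ψ d₁ d₂) atTop atBot := by
  have hz₃ : 0 < z₃ d₁ d₂ := sub_pos.2 hd₂'
  have h₁ : Tendsto (a₁ d₁ d₂) atTop (𝓝 (z₃ d₁ d₂ * -1)) := by
    refine ((tendsto_sub_div_sub_atTop (node d₁ d₂ 0) (z₁ d₁ d₂)).neg.const_mul _).congr fun t => ?_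
    rw [a₁_eq hd₂', ← div_neg, neg_sub]
  have h₂ : Tendsto (a₂ d₁ d₂) atTop (𝓝 (z₃ d₁ d₂ * -1)) := by
    refine ((tendsto_sub_div_sub_atTop (node d₁ d₂ 1) (-z₂ d₁ d₂)).neg.const_mul _).congr
      fun t => ?_
    rw [a₂_eq hd₂', ← neg_div, neg_sub, sub_neg_eq_add, add_comm]
  have hneg : (z₃ d₁ d₂ * -1) ^ 2 * (z₃ d₁ d₂ * -1) < 0 := by
    rw [mul_neg_one]
    exact mul_neg_of_pos_of_neg (sq_pos_of_neg (neg_lt_zero.2 hz₃)) (neg_lt_zero.2 hz₃)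
  refine (Tendsto.neg_mul_atTop (inv_lt_zero.2 hneg) (((h₁.pow 2).mul h₂).inv₀ hneg.ne)
    tendsto_id).congr fun t => ?_
  rw [ψ, a₃, id, mul_comm, div_eq_mul_inv]

theorem exists_mem_J₁_ψ_lt (hd₁ : 0 < d₁) (hd₂ : 0 < d₂) (hd₂' : d₂ < 1) {α : ℝ}
    (hα : α ∈ J₁ d₁ d₂) (c : ℝ) :
    (∃ x ∈ J₁ d₁ d₂, x < α ∧ ψ d₁ d₂ x < c) ∧ ∃ y ∈ J₁ d₁ d₂, α < y ∧ ψ d₁ d₂ y < c := by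
  obtain ⟨x, hx, hlt⟩ := (Eventually.and (Ioo_mem_nhdsGT hα)
    ((tendsto_ψ_nhdsGT_node_one hd₁ hd₂ hd₂').eventually_lt_atBot c)).exists
  obtain ⟨y, hy, hlt'⟩ := ((eventually_gt_atTop α).and
    ((tendsto_ψ_atTop hd₂').eventually_lt_atBot c)).exists
  exact ⟨⟨x, hx.1, hx.2, hlt⟩, y, LT.lt.trans hα hy, hy, hlt'⟩

theorem exists_mem_J₂_ψ_lt (hd₁ : 0 < d₁) (hd₂ : 0 < d₂) (hd₂' : d₂ < 1) {α c : ℝ}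
    (hα : α ∈ J₂ d₁ d₂) (hc : 0 < c) :
    (∃ x ∈ J₂ d₁ d₂, x < α ∧ ψ d₁ d₂ x < c) ∧ ∃ y ∈ J₂ d₁ d₂, α < y ∧ ψ d₁ d₂ y < c := by
  have hlt := z₁_lt_node_one hd₁ hd₂ hd₂'
  have h₀ : ψ d₁ d₂ 0 < c := by
    rwa [ψ_eq hd₂', zero_mul, zero_mul, zero_div]
  have h₁ : ψ d₁ d₂ (z₁ d₁ d₂) < c := by
    rwa [ψ_eq hd₂', sub_self, zero_pow two_ne_zero, mul_zero, zero_mul, zero_div]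
  have hcont₀ := continuousAt_ψ hd₁ hd₂ hd₂' le_rfl (hd₁.trans hlt).ne
  have hcont₁ := continuousAt_ψ hd₁ hd₂ hd₂' hd₁.le hlt.ne
  obtain ⟨x, hx, hψx⟩ := (Eventually.and (Ioo_mem_nhdsGT hα.1)
    ((hcont₀.eventually_lt_const h₀).filter_mono nhdsWithin_le_nhds)).exists
  obtain ⟨y, hy, hψy⟩ := (Eventually.and (Ioo_mem_nhdsLT hα.2)
    ((hcont₁.eventually_lt_const h₁).filter_mono nhdsWithin_le_nhds)).exists
  exact ⟨⟨x, ⟨hx.1, hx.2.trans hα.2⟩, hx.2, hψx⟩, y, ⟨LT.lt.trans hα.1 hy.1, hy.2⟩, hy.1, hψy⟩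

theorem exists_ψ_lt (hd₁ : 0 < d₁) (hd₂ : 0 < d₂) (hd₂' : d₂ < 1) {J : Set ℝ}
    (hJ : J = J₁ d₁ d₂ ∨ J = J₂ d₁ d₂) {α : ℝ} (hα : α ∈ J) (ht : t ∈ J) :
    (∃ x ∈ J, x < α ∧ ψ d₁ d₂ x < ψ d₁ d₂ t) ∧ ∃ y ∈ J, α < y ∧ ψ d₁ d₂ y < ψ d₁ d₂ t := by
  rcases hJ with rfl | rfl
  · exact exists_mem_J₁_ψ_lt hd₁ hd₂ hd₂' hα _
  · exact exists_mem_J₂_ψ_lt hd₁ hd₂ hd₂' hα (ψ_pos_of_mem_J₂ hd₁ hd₂ hd₂' ht)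

theorem nonempty_of_eq_J (hd₁ : 0 < d₁) {J : Set ℝ} (hJ : J = J₁ d₁ d₂ ∨ J = J₂ d₁ d₂) :
    J.Nonempty := by
  rcases hJ with rfl | rfl
  exacts [nonempty_Ioi, nonempty_Ioo.2 hd₁]

theorem isOpen_of_eq_J {J : Set ℝ} (hJ : J = J₁ d₁ d₂ ∨ J = J₂ d₁ d₂) : IsOpen J := by
  rcases hJ with rfl | rfl
  exacts [isOpen_Ioi, isOpen_Ioo]

theorem convex_of_eq_J {J : Set ℝ} (hJ : J = J₁ d₁ d₂ ∨ J = J₂ d₁ d₂) : Convex ℝ J := by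
  rcases hJ with rfl | rfl
  exacts [convex_Ioi _, convex_Ioo _ _]

theorem exists_isUnimodalOn_ψ (hd₁ : 0 < d₁) (hd₂ : 0 < d₂) (hd₂' : d₂ < 1) {J : Set ℝ}
    (hJ : J = J₁ d₁ d₂ ∨ J = J₂ d₁ d₂) :
    ∃ α, IsUnimodalOn (ψ d₁ d₂) J α ∧ ∀ t ∈ J, deriv (ψ d₁ d₂) t = 0 ↔ t = α := by
  have hcont := continuousOn_ψ hd₁ hd₂ hd₂' hJ
  obtain ⟨t, ht⟩ := nonempty_of_eq_J hd₁ hJ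
  obtain ⟨⟨x, hx, hxt, hψx⟩, y, hy, hty, hψy⟩ := exists_ψ_lt hd₁ hd₂ hd₂' hJ ht ht
  obtain ⟨α, hα, hmax⟩ := exists_isLocalMax_of_lt (convex_of_eq_J hJ).ordConnected hcont hx hy
    hxt hty hψx hψy
  exact ⟨α, isUnimodalOn_of_deriv_eq_neg_mul (isOpen_of_eq_J hJ) (convex_of_eq_J hJ) hα
    hmax.deriv_eq_zero hcont (fun _ ht => ψ_div_pos hd₁ hd₂ hd₂' hJ ht)
    (strictMonoOn_criticalFunction hd₁ hd₂ hd₂' hJ)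
    fun _ ht => deriv_ψ hd₁ hd₂ hd₂' (isRegularPoint_of_mem hd₁ hd₂ hd₂' hJ ht)⟩

theorem existsUnique_critical_point (hd₁ : 0 < d₁) (hd₂ : 0 < d₂) (hd₂' : d₂ < 1) {J : Set ℝ}
    (hJ : J = J₁ d₁ d₂ ∨ J = J₂ d₁ d₂) : ∃! α, α ∈ J ∧ deriv (ψ d₁ d₂) α = 0 := by
  obtain ⟨α, hα, hcrit⟩ := exists_isUnimodalOn_ψ hd₁ hd₂ hd₂' hJ
  exact ⟨α, ⟨hα.mem, (hcrit α hα.mem).2 rfl⟩, fun t ht => (hcrit t ht.1).1 ht.2⟩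

theorem existsUnique_partner (hd₁ : 0 < d₁) (hd₂ : 0 < d₂) (hd₂' : d₂ < 1) {J : Set ℝ}
    (hJ : J = J₁ d₁ d₂ ∨ J = J₂ d₁ d₂) (ht : t ∈ J) (hderiv : deriv (ψ d₁ d₂) t ≠ 0) :
    ∃! s, s ∈ J ∧ s ≠ t ∧ ψ d₁ d₂ t = ψ d₁ d₂ s := by
  obtain ⟨α, hα, hcrit⟩ := exists_isUnimodalOn_ψ hd₁ hd₂ hd₂' hJ
  exact hα.existsUnique_partner (convex_of_eq_J hJ).ordConnected (continuousOn_ψ hd₁ hd₂ hd₂' hJ)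
    (fun _ hx => (exists_ψ_lt hd₁ hd₂ hd₂' hJ hα.mem hx).1)
    (fun _ hx => (exists_ψ_lt hd₁ hd₂ hd₂' hJ hα.mem hx).2) ht fun h => hderiv ((hcrit t ht).2 h)

theorem b_nonneg_of_nested (hd₁ : 0 < d₁) (hd₂ : 0 < d₂) (hd₂' : d₂ < 1) {t' s' : ℝ} (ht : 0 < t)
    (hs : 0 < s) (ht' : 0 < t') (hs' : 0 < s')
    (h : 0 ≤ ((t - t') * (t - s')) * ((s - t') * (s - s'))) : 0 ≤ b d₁ d₂ t s t' s' := by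
  have hden : ∀ {x y : ℝ}, 0 < x → 0 < y →
      0 < x * y * z₃ d₁ d₂ + z₁ d₁ d₂ * z₂ d₁ d₂ * z₄ d₁ d₂ := fun hx hy =>
    add_pos (mul_pos (mul_pos hx hy) (sub_pos.2 hd₂'))
      (mul_pos (mul_pos hd₁ hd₂) (add_pos one_pos hd₁))
  have hmul : 0 ≤ (cf d₁ d₂ t t' * cf d₁ d₂ s s') * (cf d₁ d₂ s t' * cf d₁ d₂ t s') := by
    simp only [cf]
    rw [div_mul_div_comm, div_mul_div_comm, div_mul_div_comm]
    exact div_nonneg (by linarith) (mul_pos (mul_pos (hden ht ht') (hden hs hs'))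
      (mul_pos (hden hs ht') (hden ht hs'))).le
  exact div_nonneg_iff.2 (mul_nonneg_iff.1 hmul)

theorem b_nonneg (hd₁ : 0 < d₁) (hd₂ : 0 < d₂) (hd₂' : d₂ < 1) {J J' : Set ℝ}
    (hJ : J = J₁ d₁ d₂ ∨ J = J₂ d₁ d₂) (hJ' : J' = J₁ d₁ d₂ ∨ J' = J₂ d₁ d₂) {t' s' : ℝ}
    (ht : t ∈ J) (hs : s ∈ J) (ht' : t' ∈ J') (hs' : s' ∈ J') (hψ : ψ d₁ d₂ t = ψ d₁ d₂ s)
    (hψ' : ψ d₁ d₂ t' = ψ d₁ d₂ s') : 0 ≤ b d₁ d₂ t s t' s' := by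
  have hpos : ∀ {x}, x ∈ J → 0 < x := fun hx => (isRegularPoint_of_mem hd₁ hd₂ hd₂' hJ hx).pos
  have hpos' : ∀ {x}, x ∈ J' → 0 < x := fun hx => (isRegularPoint_of_mem hd₁ hd₂ hd₂' hJ' hx).pos
  have hsep : ∀ {x y}, x ∈ J₁ d₁ d₂ → y ∈ J₂ d₁ d₂ → y < x := fun hx hy =>
    LT.lt.trans hy.2 (z₁_lt_of_mem_J₁ hd₁ hd₂ hd₂' hx)
  refine b_nonneg_of_nested hd₁ hd₂ hd₂' (hpos ht) (hpos hs) (hpos' ht') (hpos' hs') ?_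
  obtain ⟨α, hα, -⟩ := exists_isUnimodalOn_ψ hd₁ hd₂ hd₂' hJ
  rcases hJ with rfl | rfl <;> rcases hJ' with rfl | rfl
  · exact hα.nested ht hs ht' hs' hψ hψ'
  · have hsub : ∀ {x y}, x ∈ J₁ d₁ d₂ → y ∈ J₂ d₁ d₂ → 0 ≤ x - y := fun hx hy =>
      (sub_pos.2 (hsep hx hy)).le
    exact mul_nonneg (mul_nonneg (hsub ht ht') (hsub ht hs'))
      (mul_nonneg (hsub hs ht') (hsub hs hs'))
  · have hsub : ∀ {x y}, x ∈ J₂ d₁ d₂ → y ∈ J₁ d₁ d₂ → x - y ≤ 0 := fun hx hy =>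
      (sub_neg.2 (hsep hy hx)).le
    exact mul_nonneg (mul_nonneg_of_nonpos_of_nonpos (hsub ht ht') (hsub ht hs'))
      (mul_nonneg_of_nonpos_of_nonpos (hsub hs ht') (hsub hs hs'))
  · exact hα.nested ht hs ht' hs' hψ hψ'

theorem φ_div_φ_pos (hd₁ : 0 < d₁) (hd₂ : 0 < d₂) (hd₂' : d₂ < 1) {J : Set ℝ}
    (hJ : J = J₁ d₁ d₂ ∨ J = J₂ d₁ d₂) (ht : t ∈ J) (hs : s ∈ J) (m n : ℤ) :
    0 < φ d₁ d₂ m n t / φ d₁ d₂ m n s := by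
  have h₃ : 0 < a₃ d₁ d₂ t / a₃ d₁ d₂ s := div_pos
    (isRegularPoint_of_mem hd₁ hd₂ hd₂' hJ ht).pos (isRegularPoint_of_mem hd₁ hd₂ hd₂' hJ hs).pos
  have h₁ : 0 < a₁ d₁ d₂ t / a₁ d₁ d₂ s := by
    rcases hJ with rfl | rfl
    · exact div_pos_of_neg_of_neg (a₁_neg_of_mem_J₁ hd₁ hd₂ hd₂' ht)
        (a₁_neg_of_mem_J₁ hd₁ hd₂ hd₂' hs)
    · exact div_pos (a₁_pos_of_mem_J₂ hd₁ hd₂ hd₂' ht) (a₁_pos_of_mem_J₂ hd₁ hd₂ hd₂' hs)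
  rw [φ_div_φ]
  exact mul_pos (zpow_pos (div_pos h₃ h₁) m) (zpow_pos h₁ n)

end Dispersion

section Positivity

variable {d₁ d₂ : ℝ} {N : ℕ} {c t s : Fin N → ℝ}

theorem soliton_pos (hd₁ : 0 < d₁) (hd₂ : 0 < d₂) (hd₂' : d₂ < 1) {J : Fin N → Set ℝ}
    (hJ : ∀ i, J i = J₁ d₁ d₂ ∨ J i = J₂ d₁ d₂) (ht : ∀ i, t i ∈ J i) (hs : ∀ i, s i ∈ J i)
    (hψ : ∀ i, ψ d₁ d₂ (t i) = ψ d₁ d₂ (s i)) (hc : ∀ i, 0 < c i) (m n : ℤ) :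
    0 < soliton d₁ d₂ c t s m n := by
  refine Finset.sum_pos' (fun I _ => mul_nonneg ?_ ?_) ⟨∅, Finset.mem_univ _, ?_⟩
  · exact Finset.prod_nonneg fun i _ =>
      (mul_pos (hc i) (φ_div_φ_pos hd₁ hd₂ hd₂' (hJ i) (ht i) (hs i) m n)).le
  · exact Finset.prod_nonneg fun i _ => Finset.prod_nonneg fun j _ =>
      b_nonneg hd₁ hd₂ hd₂' (hJ i) (hJ j) (ht i) (hs i) (ht j) (hs j) (hψ i) (hψ j)
  · rw [Finset.prod_empty, Finset.prod_empty, mul_one]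
    exact one_pos

end Positivity

theorem isSolution_zero_iff (d₁ : ℝ) (f : ℤ → ℤ → ℝ) :
    IsSolution d₁ 0 f ↔ IsDiscreteKdVSolution d₁ f := by
  simp only [IsSolution, IsDiscreteKdVSolution, zero_mul, add_zero, sub_zero, one_mul]

end DMix

theorem mainTheorem2_general (d₁ d₂ : ℝ) (hd₁ : 0 < d₁) (hd₂ : 0 < d₂) (hd₂' : d₂ < 1) :
    (∀ (N : ℕ) (c t s : Fin N → ℝ),
      (∀ i, (t i ∈ DMix.J₁ d₁ d₂ ∧ s i ∈ DMix.J₁ d₁ d₂) ∨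
        (t i ∈ DMix.J₂ d₁ d₂ ∧ s i ∈ DMix.J₂ d₁ d₂)) →
      (∀ i, DMix.ψ d₁ d₂ (t i) = DMix.ψ d₁ d₂ (s i)) →
      (∀ i j, i ≠ j → t i ≠ s j) →
      DMix.IsSolution d₁ d₂ (DMix.soliton d₁ d₂ c t s) ∧
        ((∀ i, 0 < c i) → ∀ m n : ℤ, 0 < DMix.soliton d₁ d₂ c t s m n)) ∧
    (∀ J : Set ℝ, J = DMix.J₁ d₁ d₂ ∨ J = DMix.J₂ d₁ d₂ →
      (∃! α, α ∈ J ∧ deriv (DMix.ψ d₁ d₂) α = 0) ∧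
        ∀ t ∈ J, deriv (DMix.ψ d₁ d₂) t ≠ 0 →
          ∃! s, s ∈ J ∧ s ≠ t ∧ DMix.ψ d₁ d₂ t = DMix.ψ d₁ d₂ s) ∧
    (∀ f : ℤ → ℤ → ℝ, DMix.IsSolution d₁ 0 f ↔ DMix.IsDiscreteKdVSolution d₁ f) := by
  refine ⟨fun N c t s hmem hψ hts => ?_, fun J hJ =>
      ⟨DMix.existsUnique_critical_point hd₁ hd₂ hd₂' hJ, fun t ht =>
        DMix.existsUnique_partner hd₁ hd₂ hd₂' hJ ht⟩,
    DMix.isSolution_zero_iff d₁⟩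
  have hinterval : ∀ i, ∃ J, (J = DMix.J₁ d₁ d₂ ∨ J = DMix.J₂ d₁ d₂) ∧ t i ∈ J ∧ s i ∈ J :=
    fun i => (hmem i).elim (fun h => ⟨_, Or.inl rfl, h⟩) fun h => ⟨_, Or.inr rfl, h⟩
  choose J hJ ht hs using hinterval
  exact ⟨DMix.isSolution_soliton hd₁ hd₂ hd₂'
      (fun i => DMix.isRegularPoint_of_mem hd₁ hd₂ hd₂' (hJ i) (ht i))
      (fun i => DMix.isRegularPoint_of_mem hd₁ hd₂ hd₂' (hJ i) (hs i)) hts hψ,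
    DMix.soliton_pos hd₁ hd₂ hd₂' hJ ht hs hψ⟩

theorem mainTheorem2 (d₁ d₂ : ℝ) (hd₂ : 0 < d₂) (hd : d₂ < d₁) (hd₁ : d₁ < 1) :
    -- the soliton function solves the equation, and it is positive for positive `c`
    (∀ (N : ℕ) (c t s : Fin N → ℝ),
      (∀ i, (t i ∈ DMix.J₁ d₁ d₂ ∧ s i ∈ DMix.J₁ d₁ d₂) ∨
        (t i ∈ DMix.J₂ d₁ d₂ ∧ s i ∈ DMix.J₂ d₁ d₂)) →
      (∀ i, DMix.ψ d₁ d₂ (t i) = DMix.ψ d₁ d₂ (s i)) →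
      -- the denominators of the coupling factors do not vanish
      (∀ i j, i ≠ j → t i ≠ s j) →
      DMix.IsSolution d₁ d₂ (DMix.soliton d₁ d₂ c t s) ∧
        ((∀ i, 0 < c i) → ∀ m n : ℤ, 0 < DMix.soliton d₁ d₂ c t s m n)) ∧
    -- each interval has one critical point, and every other point has a unique partner
    (∀ J : Set ℝ, J = DMix.J₁ d₁ d₂ ∨ J = DMix.J₂ d₁ d₂ →
      (∃! α, α ∈ J ∧ deriv (DMix.ψ d₁ d₂) α = 0) ∧
        ∀ t ∈ J, deriv (DMix.ψ d₁ d₂) t ≠ 0 →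
          ∃! s, s ∈ J ∧ s ≠ t ∧ DMix.ψ d₁ d₂ t = DMix.ψ d₁ d₂ s) ∧
    -- at `d₂ = 0` the equation is the discrete KdV equation
    (∀ f : ℤ → ℤ → ℝ, DMix.IsSolution d₁ 0 f ↔ DMix.IsDiscreteKdVSolution d₁ f) :=
  mainTheorem2_general d₁ d₂ (hd₂.trans hd) hd₂ (hd.trans hd₁)
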